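/- **Setting.** For a finite set $S$, a *subdistribution* is a map $\mu:S\to[0,1]$ of size $|\mu|=\sum_s\mu(s)\le 1$; it is a *distribution*, $\mu\in Dist(S)$, if $|\mu|=1$. Write $\mu(C)=\sum_{s\in C}\mu(s)$, $Supp(\mu)=\{s:\mu(s)>0\}$, $\Delta_s$ for the Dirac distribution on $s$, $\oplus$ for pointwise sum, and $\mu-s$ for $\mu$ with its mass at $s$ replaced by $0$. A (finite) *Markov automaton* $M$ consists of a finite set $S$ of states, a finite set $Act$ of actions with an internal action $\tau\in Act$, a finite set of probabilistic transitions in $S\times Act\times Dist(S)$, a finite set of timed transitions in $S\times\mathbb R_{\ge0}\times S$, and an initial state $s_0 \in S$. Let $rate(s,s')$ be the sum of all $\lambda$ for which $(s,\lambda,s')$ is a timed transition, $rate(s)=\sum_{s'}rate(s,s')$, and let $P_s(s')=rate(s,s')/rate(s)$ if $rate(s)\ne0$, and $P_s=\Delta_s$ otherwise. A state is *stable* if it has no probabilistic transition labelled $\tau$. Let $Act^\chi$ be the disjoint union of $Act$ and $\{\chi(rate(s)) : s\in S\}$. The transitions $s\xrightarrow{\alpha}\mu$ ($\alpha\in Act^\chi$)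 of the probabilistic automaton $PA(M)$ are the probabilistic transitions of $M$, together with $s\xrightarrow{\chi(rate(s))}P_s$ for every stable $s$. A *transition tree* is a finitely branching, possibly infinite rooted ordered tree whose nodes $\sigma$ carry a state $Sta(\sigma)$, a number $Prob(\sigma)\ge0$ and a label $Act(\sigma)\in Act^\chi\cup\{\bot\}$, such that the root has $Prob=1$, every leaf has label $\bot$, and every node $\sigma$ that is not a leaf satisfies $Sta(\sigma)\xrightarrow{Act(\sigma)}\mu$ for some $\mu$ with $Prob(\sigma)\mu=\bigoplus_{\sigma'}Prob(\sigma')\Delta_{Sta(\sigma')}$, the sum running over the children $\sigma'$ of $\sigma$. It *induces* the subdistribution $\bigoplus_{\sigma\text{ leaf}}Prob(\sigma)\Delta_{Sta(\sigma)}$. - $s\Rightarrow\mu$: some transition tree with root state $s$, all of whose non-leaf nodes are labelled $\tau$, induces $\mu$. - $s\stackrel{\hat\tau}{\Rightarrow}\mu$ means $s\Rightarrow\mu$. For $\alpha\ne\tau$, $s\stackrel{\hat\alpha}{\Rightarrow}\mu$ means that $\mu$ is induced by some transition tree with root state $s$, whose non-leaf nodes are labelled $\alpha$ or $\tau$, in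 which every path from the root to a leaf contains exactly one node labelled $\alpha$. - The *combined* transitions $\Rightarrow_C$ and $\stackrel{\hat\alpha}{\Rightarrow}_C$ from a state $s$ lead to the finite convex combinations of subdistributions reached from $s$ by $\Rightarrow$ and $\stackrel{\hat\alpha}{\Rightarrow}$ respectively. - Each of these relations $\rightsquigarrow$ extends to subdistributions: $\mu\rightsquigarrow\gamma$ iff there are $\gamma_s$ with $s\rightsquigarrow\gamma_s$ for $s\in Supp(\mu)$ and $\gamma=\bigoplus_{s\in Supp(\mu)}\mu(s)\gamma_s$. A relation $\mathcal R$ on subdistributions is a *weak bisimulation* if $\mu_1\mathcal R\mu_2$ implies: (A) $|\mu_1|=|\mu_2|$; (B) for all $s\in Supp(\mu_1)$ and $\alpha\in Act^\chi$ there are $\mu_2^g,\mu_2^b$ with $\mu_2\Rightarrow_C\mu_2^g\oplus\mu_2^b$, $(\mu_1(s)\Delta_s)\,\mathcal R\,\mu_2^g$, $(\mu_1-s)\,\mathcal R\,\mu_2^b$, and whenever $s\xrightarrow{\alpha}\mu_1'$ there is $\mu''$ with $\mu_2^g\stackrel{\hat\alpha}{\Rightarrow}_C\mu''$ and $(\mu_1(s)\mu_1')\,\mathcal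 R\,\mu''$; (C) the symmetric condition with the two sides interchanged. Write $\mu\approx\gamma$ if $(\mu,\gamma)$ lies in some weak bisimulation, $s\approx_\Delta t$ if $\Delta_s\approx\Delta_t$, and $S/{\approx_\Delta}$ for the set of classes $\{t : s\approx_\Delta t\}$, $s\in S$. **Theorem.** Let $M$ be a finite Markov automaton with state space $S$, let $E,F\in S$ and $\mu,\gamma\in Dist(S)$. Then: 1. $E\approx_\Delta F$ if and only if for every $\alpha\in Act^\chi$ both of the following hold: (a) whenever $E\xrightarrow{\alpha}\mu_0$, there is $\gamma_0$ with $F\stackrel{\hat\alpha}{\Rightarrow}_C\gamma_0$ and $\mu_0\approx\gamma_0$; (b) whenever $F\xrightarrow{\alpha}\gamma_0$, there is $\mu_0$ with $E\stackrel{\hat\alpha}{\Rightarrow}_C\mu_0$ and $\gamma_0\approx\mu_0$. 2. $\mu\approx\gamma$ if and only if there are $\mu',\gamma'$ with $\mu\Rightarrow\mu'$, $\gamma\Rightarrow\gamma'$, $\mu\approx\mu'$, $\gamma\approx\gamma'$ and $\mu'(C)=\gamma'(C)$ for all $C\in S/{\approx_\Delta}$. -/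

import Mathlib

open scoped NNReal

/-! ### Distributions on a finite set

Mass functions are maps `S → ℝ≥0`; `⊕` is pointwise `+` and `c μ` is `c • μ`. -/

/-- Size `|μ| = μ(S)`. -/
def size {S : Type*} [Fintype S] (μ : S → ℝ≥0) : ℝ≥0 := ∑ s, μ s

/-- `μ` is a subdistribution. -/
def IsSubdist {S : Type*} [Fintype S] (μ : S → ℝ≥0) : Prop := size μ ≤ 1

/-- `μ` is a distribution. -/
def IsDist {S : Type*} [Fintype S] (μ : S → ℝ≥0) : Prop := size μ = 1

/-- `μ(C)` for a set `C` of states. -/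
noncomputable def massOn {S : Type*} [Fintype S] (μ : S → ℝ≥0) (C : Set S) : ℝ≥0 :=
  ∑ s, C.indicator μ s

/-- The Dirac distribution on `s`. -/
def dirac {S : Type*} [DecidableEq S] (s : S) : S → ℝ≥0 := Pi.single s 1

/-- `μ - s`: the mass at `s` is removed, everything else is kept. -/
def removeState {S : Type*} [DecidableEq S] (μ : S → ℝ≥0) (s : S) : S → ℝ≥0 :=
  Function.update μ s 0

/-! ### Markov automata -/

/-- A (finite) Markov automaton with state space `S` and action set `Act`. -/
structure MarkovAutomaton (S Act : Type*) [Fintype S] where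
  /-- the internal action -/
  tau : Act
  /-- the action-labelled probabilistic transitions -/
  pt : Finset (S × Act × (S → ℝ≥0))
  pt_dist : ∀ t ∈ pt, IsDist t.2.2
  /-- the Markovian timed transitions -/
  mt : Finset (S × ℝ≥0 × S)
  /-- the initial state -/
  init : S

namespace MarkovAutomaton

variable {S Act : Type*} [Fintype S] [DecidableEq S]

/-- `s` is stable: it has no emanating `τ` transition. -/
def Stable (M : MarkovAutomaton S Act) (s : S) : Prop := ¬ ∃ μ, (s, M.tau, μ) ∈ M.pt

/-- `rate(s, s')`. -/
def rate (M : MarkovAutomaton S Act) (s s' : S) : ℝ≥0 :=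
  ∑ t ∈ M.mt with t.1 = s ∧ t.2.2 = s', t.2.1

/-- The exit rate `rate(s)`. -/
def exitRate (M : MarkovAutomaton S Act) (s : S) : ℝ≥0 := ∑ s', M.rate s s'

/-- The distribution `P_s` on successor states. -/
noncomputable def succDist (M : MarkovAutomaton S Act) (s : S) : S → ℝ≥0 :=
  open Classical in
  if M.exitRate s ≠ 0 then fun s' => M.rate s s' / M.exitRate s else dirac s

/-- `Act^χ`: the disjoint union of `Act` and `{χ(r) | r is the exit rate of some state}`. -/
abbrev ActChi (M : MarkovAutomaton S Act) : Type _ := Act ⊕ Set.range M.exitRate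

/-- The action `τ` as an element of `Act^χ`. -/
abbrev tauChi (M : MarkovAutomaton S Act) : M.ActChi := Sum.inl M.tau

/-- The transitions `s --α--> μ` of the probabilistic automaton `PA(M)`. -/
def Step (M : MarkovAutomaton S Act) (s : S) (α : M.ActChi) (μ : S → ℝ≥0) : Prop :=
  match α with
  | Sum.inl a => (s, a, μ) ∈ M.pt
  | Sum.inr r => M.Stable s ∧ (r : ℝ≥0) = M.exitRate s ∧ μ = M.succDist s

end MarkovAutomaton

/-! ### Labelled trees -/

/-- A finitely branching, possibly infinite `L`-labelled tree. Nodes are finite sequences of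
numbers, the children of a node being numbered from `0`. The values of `label` outside `nodes`
carry no information. -/
structure LabelledTree (L : Type*) where
  nodes : Set (List ℕ)
  label : List ℕ → L
  prefix_mem : ∀ σ σ' : List ℕ, σ' ∈ nodes → σ <+: σ' → σ ∈ nodes
  sibling_mem : ∀ (σ : List ℕ) (i : ℕ), σ ++ [i + 1] ∈ nodes → σ ++ [i] ∈ nodes
  root_mem : [] ∈ nodes
  finite_branching : ∀ σ : List ℕ, {i : ℕ | σ ++ [i] ∈ nodes}.Finite

namespace LabelledTree

/-- The leaves: nodes that are not a proper prefix of another node. -/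
def leaves {L : Type*} (T : LabelledTree L) : Set (List ℕ) :=
  {σ | σ ∈ T.nodes ∧ ¬ ∃ σ' ∈ T.nodes, σ <+: σ' ∧ σ ≠ σ'}

/-- The inner nodes that are not leaves. -/
def inner {L : Type*} (T : LabelledTree L) : Set (List ℕ) := T.nodes \ T.leaves

/-- The numbers `i` for which `σ i` is a child of `σ`. -/
noncomputable def children {L : Type*} (T : LabelledTree L) (σ : List ℕ) : Finset ℕ :=
  (T.finite_branching σ).toFinset

end LabelledTree

namespace MarkovAutomaton

variable {S Act : Type*} [Fintype S] [DecidableEq S]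

/-! ### Transition trees and weak transitions -/

/-- Trees labelled with a state, a probability and an action or `⊥` (here `none`). -/
abbrev Tree (M : MarkovAutomaton S Act) : Type _ := LabelledTree (S × ℝ≥0 × Option M.ActChi)

/-- `Sta_T(σ)`. -/
def Tree.sta {M : MarkovAutomaton S Act} (T : M.Tree) (σ : List ℕ) : S := (T.label σ).1

/-- `Prob_T(σ)`. -/
def Tree.prob {M : MarkovAutomaton S Act} (T : M.Tree) (σ : List ℕ) : ℝ≥0 := (T.label σ).2.1

/-- `Act_T(σ)`. -/
def Tree.act {M : MarkovAutomaton S Act} (T : M.Tree) (σ : List ℕ) : Option M.ActChi :=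
  (T.label σ).2.2

/-- `T` is a transition tree over `M`. -/
structure IsTransitionTree (M : MarkovAutomaton S Act) (T : M.Tree) : Prop where
  prob_root : T.prob [] = 1
  act_leaf : ∀ σ ∈ T.leaves, T.act σ = none
  step_inner : ∀ σ ∈ T.inner, ∃ (α : M.ActChi) (μ : S → ℝ≥0),
    T.act σ = some α ∧ M.Step (T.sta σ) α μ ∧
      T.prob σ • μ = ∑ i ∈ T.children σ, T.prob (σ ++ [i]) • dirac (T.sta (σ ++ [i]))

/-- `μ = μ_T`: the subdistribution `μ` is induced by `T`. -/
def Induces (M : MarkovAutomaton S Act) (T : M.Tree) (μ : S → ℝ≥0) : Prop :=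
  HasSum (fun σ : T.leaves => T.prob (σ : List ℕ) • dirac (T.sta (σ : List ℕ))) μ

/-- `s ⇒ μ`. -/
def Weak (M : MarkovAutomaton S Act) (s : S) (μ : S → ℝ≥0) : Prop :=
  ∃ T : M.Tree, M.IsTransitionTree T ∧ T.sta [] = s ∧ M.Induces T μ ∧
    ∀ σ ∈ T.inner, T.act σ = some M.tauChi

/-- `s ==α==> μ`. The nodes on the path from the root to a leaf `σ` are the prefixes of `σ`. -/
def WeakAct (M : MarkovAutomaton S Act) (α : M.ActChi) (s : S) (μ : S → ℝ≥0) : Prop :=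
  ∃ T : M.Tree, M.IsTransitionTree T ∧ T.sta [] = s ∧ M.Induces T μ ∧
    (∀ σ ∈ T.leaves, ∃ ρ, ρ <+: σ ∧ T.act ρ = some α) ∧
    (α ≠ M.tauChi → ∀ σ ∈ T.leaves, ∃! ρ, ρ <+: σ ∧ T.act ρ = some α) ∧
    ∀ σ ∈ T.inner, T.act σ = some α ∨ T.act σ = some M.tauChi

/-- `s ==α̂==> μ`. -/
def WeakHat (M : MarkovAutomaton S Act) (α : M.ActChi) (s : S) (μ : S → ℝ≥0) : Prop :=
  (α = M.tauChi ∧ M.Weak s μ) ∨ (α ≠ M.tauChi ∧ M.WeakAct α s μ)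

end MarkovAutomaton

/-- Combined transitions: `s` reaches `μ` by a finite convex combination of transitions `Q`. -/
def Combined {S : Type*} (Q : S → (S → ℝ≥0) → Prop) (s : S) (μ : S → ℝ≥0) : Prop :=
  ∃ (n : ℕ) (c : Fin n → ℝ≥0) (ν : Fin n → S → ℝ≥0),
    (∀ i, 0 < c i) ∧ ∑ i, c i = 1 ∧ (∀ i, Q s (ν i)) ∧ μ = ∑ i, c i • ν i

/-- Transitions between subdistributions: every state `s` in the support of `μ` makes a
transition to some `ν s`, and `γ` is the sum of the `μ(s) ν s` (terms with `μ(s) = 0` vanish). -/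
def Lifted {S : Type*} [Fintype S] (Q : S → (S → ℝ≥0) → Prop) (μ γ : S → ℝ≥0) : Prop :=
  ∃ ν : S → S → ℝ≥0, (∀ s, 0 < μ s → Q s (ν s)) ∧ γ = ∑ s, μ s • ν s

namespace MarkovAutomaton

variable {S Act : Type*} [Fintype S] [DecidableEq S]

/-! ### Weak bisimulation -/

/-- The condition on a pair `(μ₁, μ₂)` that `μ₂` answers every state and transition of `μ₁`. -/
def Answers (M : MarkovAutomaton S Act) (R : (S → ℝ≥0) → (S → ℝ≥0) → Prop)
    (μ₁ μ₂ : S → ℝ≥0) : Prop :=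
  ∀ s, 0 < μ₁ s → ∀ α : M.ActChi, ∃ μg μb : S → ℝ≥0,
    Lifted (Combined M.Weak) μ₂ (μg + μb) ∧
    R (μ₁ s • dirac s) μg ∧ R (removeState μ₁ s) μb ∧
    ∀ μ₁' : S → ℝ≥0, M.Step s α μ₁' →
      ∃ μ'' : S → ℝ≥0, Lifted (Combined (M.WeakHat α)) μg μ'' ∧ R (μ₁ s • μ₁') μ''

/-- `R` is a weak bisimulation (a relation on subdistributions). -/
structure IsWeakBisimulation (M : MarkovAutomaton S Act)
    (R : (S → ℝ≥0) → (S → ℝ≥0) → Prop) : Prop where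
  subdist : ∀ μ₁ μ₂, R μ₁ μ₂ → IsSubdist μ₁ ∧ IsSubdist μ₂
  size_eq : ∀ μ₁ μ₂, R μ₁ μ₂ → size μ₁ = size μ₂
  left : ∀ μ₁ μ₂, R μ₁ μ₂ → M.Answers R μ₁ μ₂
  right : ∀ μ₁ μ₂, R μ₁ μ₂ → M.Answers (fun x y => R y x) μ₂ μ₁

/-- `μ ≈ γ`. -/
def Bisim (M : MarkovAutomaton S Act) (μ γ : S → ℝ≥0) : Prop :=
  ∃ R, M.IsWeakBisimulation R ∧ R μ γ

/-- `s ≈_Δ t`. -/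
def StateBisim (M : MarkovAutomaton S Act) (s t : S) : Prop := M.Bisim (dirac s) (dirac t)

/-- The set `S / ≈_Δ` of classes of states. -/
def bisimClasses (M : MarkovAutomaton S Act) : Set (Set S) :=
  {C | ∃ s, C = {t | M.StateBisim s t}}

end MarkovAutomaton

/-!
The proof replaces trees by *flows*. A flow from `μ` to `γ` uses every transition a finite expected
number of times so that in each state the incoming and the outgoing mass agree (`MassFlow`). Flows
form a finitely generated cone, hence they compose, add up and are closed under limits. If states
record whether the visible action has been used, then the combined weak transitions that lose no
mass are exactly the flows. Cutting a tree at depth `n` gives a flow, and the cuts converge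
(`IsUnfolding.massFlow`). Conversely a flow is realized by a randomized memoryless policy
(`MassFlow.exists_policy`); only the decision at the root needs a convex combination, because
the children of a node may repeat a state with different continuations (`MassFlow.exists_trees`).

In these terms weak bisimilarity `≈` (`FlowBisim`, without restriction on sizes) is additive,
homogeneous and, by compactness, closed. What is bisimilar to `x + x'` evolves internally into a sum
of parts bisimilar to `x` and `x'` (`FlowBisim.split`). So single transitions can be simulated, and
then, by closedness, all flows (`FlowBisim.simulate`). This gives transitivity and the step
condition for bisimilar states. Moreover `≈` is cancellative: from `x + y ≈ x + z` follows
`x + n y ≈ x + n z`, and scaling by `1 / n` gives `y ≈ z` in the limit.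

For the normal form of distributions, write `s ⤳ t` if `s` evolves internally into some `ρ ≈ s` with
`ρ t > 0`. This is a preorder on a finite set. By a maximality argument (`exists_move_into`) every
state evolves into a bisimilar mass function on bottom states, and what a bottom state evolves into
without changing its class stays within its class of states. By cancellation no randomization is
needed at the root (`Move.of_mixture`), and bisimilar mass functions on bottom states give every
class the same mass (`massOn_eq_of_bottom`). Conversely, mass functions that agree on classes are
bisimilar by additivity.
-/

open scoped NNReal

set_option linter.unusedSectionVars false

/-! ### Finitely generated cones are closed -/

/-- Carathéodory's argument: either the generators are linearly independent, and the cone is the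
image of an orthant under a closed embedding, or one generator can always be dispensed with, and
the cone is a finite union of cones with fewer generators. -/
theorem isClosed_cone_of_finset {ι V : Type*} [NormedAddCommGroup V]
    [NormedSpace ℝ V] [FiniteDimensional ℝ V] (a : ι → V) (s : Finset ι) :
    IsClosed {v : V | ∃ c : ι → ℝ, (∀ i ∈ s, 0 ≤ c i) ∧ v = ∑ i ∈ s, c i • a i} := by
  classical
  induction s using Finset.strongInduction with
  | H s ih =>
  by_cases hli : LinearIndependent ℝ (fun i : s => a i)
  · have hinj : Function.Injective (Fintype.linearCombination ℝ (fun i : s => a i)) :=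
      hli.fintypeLinearCombination_injective
    have hemb := LinearMap.isClosedEmbedding_of_injective (LinearMap.ker_eq_bot.mpr hinj)
    have horth : IsClosed {c : s → ℝ | ∀ i, 0 ≤ c i} := by
      simp only [Set.ofPred_forall]
      exact isClosed_iInter fun i => isClosed_le continuous_const (continuous_apply i)
    convert hemb.isClosedMap _ horth using 1
    ext v
    simp only [Set.mem_ofPred_eq, Set.mem_image, Fintype.linearCombination_apply]
    constructor
    · rintro ⟨c, hc, rfl⟩
      exact ⟨fun i => c i, fun i => hc i i.2, Finset.sum_coe_sort s fun i => c i • a i⟩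
    · rintro ⟨c, hc, rfl⟩
      refine ⟨fun i => if h : i ∈ s then c ⟨i, h⟩ else 0, fun i hi => by simp [hi, hc], ?_⟩
      rw [← Finset.sum_coe_sort s]
      exact Finset.sum_congr rfl fun i _ => by simp
  · obtain ⟨g, hg, j₀, hj₀⟩ := Fintype.not_linearIndependent_iff.mp hli
    obtain ⟨g, hgs, j₀, hj₀s, hj₀⟩ :
        ∃ g : ι → ℝ, ∑ i ∈ s, g i • a i = 0 ∧ ∃ j ∈ s, 0 < g j := by
      let g' : ι → ℝ := fun i => if h : i ∈ s then g ⟨i, h⟩ else 0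
      have hg' : ∑ i ∈ s, g' i • a i = 0 := by
        rw [← hg, ← Finset.sum_coe_sort s]
        exact Finset.sum_congr rfl fun i _ => by simp [g']
      have hj' : g' j₀ = g j₀ := by simp [g']
      rcases lt_or_gt_of_ne hj₀ with h | h
      · exact ⟨-g', by simp [hg'], j₀, j₀.2, by simpa [hj'] using h⟩
      · exact ⟨g', hg', j₀, j₀.2, by simpa [hj'] using h⟩
    have hunion : {v : V | ∃ c : ι → ℝ, (∀ i ∈ s, 0 ≤ c i) ∧ v = ∑ i ∈ s, c i • a i} =
        ⋃ j ∈ s, {v : V | ∃ c : ι → ℝ, (∀ i ∈ s.erase j, 0 ≤ c i) ∧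
          v = ∑ i ∈ s.erase j, c i • a i} := by
      ext v
      simp only [Set.mem_ofPred_eq, Set.mem_iUnion]
      constructor
      · rintro ⟨c, hc, rfl⟩
        -- subtract the largest multiple of the linear relation that keeps all coefficients `≥ 0`
        obtain ⟨j, hj, hmin⟩ := (s.filter fun i => 0 < g i).exists_min_image
          (fun i => c i / g i) ⟨j₀, by simp [hj₀s, hj₀]⟩
        simp only [Finset.mem_filter] at hj hmin
        refine ⟨j, hj.1, fun i => c i - c j / g j * g i, fun i hi => ?_, ?_⟩
        · have his := Finset.mem_of_mem_erase hi
          rcases le_or_gt (g i) 0 with h | h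
          · have h1 : 0 ≤ c j / g j := div_nonneg (hc j hj.1) hj.2.le
            nlinarith [hc i his, mul_nonneg h1 (neg_nonneg.mpr h)]
          · have := (le_div_iff₀ h).mp (hmin i ⟨his, h⟩)
            linarith
        · rw [← Finset.sum_erase_add _ _ hj.1] at hgs ⊢
          have h0 : c j - c j / g j * g j = 0 := by field_simp [hj.2.ne']; ring
          have : ∑ i ∈ s.erase j, (c i - c j / g j * g i) • a i =
              ∑ i ∈ s.erase j, c i • a i - (c j / g j) • ∑ i ∈ s.erase j, g i • a i := by
            simp only [sub_smul, Finset.sum_sub_distrib, Finset.smul_sum, smul_smul]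
          rw [this, eq_neg_of_add_eq_zero_left hgs, smul_neg, sub_neg_eq_add, smul_smul,
            sub_eq_zero.mp h0.symm.symm |>.symm]
      · rintro ⟨j, hj, c, hc, rfl⟩
        refine ⟨fun i => if i = j then 0 else c i, fun i hi => ?_, ?_⟩
        · by_cases h : i = j
          · simp [h]
          · simpa [h] using hc i (Finset.mem_erase.mpr ⟨h, hi⟩)
        · rw [← Finset.sum_erase_add _ _ hj]
          simp only [if_true, zero_smul, add_zero]
          exact Finset.sum_congr rfl fun i hi => by simp [Finset.ne_of_mem_erase hi]
    rw [hunion]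
    exact isClosed_biUnion_finset fun j hj => ih _ (Finset.erase_ssubset hj)

/-! ### Mass functions -/

section Mass

variable {X Y Z : Type*} [Fintype X] [DecidableEq X] [Fintype Y] [DecidableEq Y]
  [Fintype Z] [DecidableEq Z]

/-- The image of a mass function under a map of states. -/
def push (φ : X → Y) : (X → ℝ≥0) →ₗ[ℝ≥0] (Y → ℝ≥0) where
  toFun ξ := ∑ x, ξ x • dirac (φ x)
  map_add' ξ ξ' := by simp [add_smul, Finset.sum_add_distrib]
  map_smul' c ξ := by simp [Finset.smul_sum, smul_smul]

/-- The size as a linear map. -/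
def sizeLin : (X → ℝ≥0) →ₗ[ℝ≥0] ℝ≥0 where
  toFun := size
  map_add' ξ ξ' := by simp [size, Finset.sum_add_distrib]
  map_smul' c ξ := by simp [size, Finset.mul_sum]

theorem size_add (μ ν : X → ℝ≥0) : size (μ + ν) = size μ + size ν := sizeLin.map_add μ ν

theorem size_smul (c : ℝ≥0) (μ : X → ℝ≥0) : size (c • μ) = c * size μ := sizeLin.map_smul c μ

theorem size_sum {ι : Type*} (s : Finset ι) (f : ι → X → ℝ≥0) :
    size (∑ i ∈ s, f i) = ∑ i ∈ s, size (f i) := map_sum sizeLin f s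

@[simp] theorem size_zero : size (0 : X → ℝ≥0) = 0 := sizeLin.map_zero

@[simp] theorem size_dirac (x : X) : size (dirac x) = 1 := by
  simp [size, dirac]

theorem size_eq_zero {μ : X → ℝ≥0} : size μ = 0 ↔ μ = 0 := by
  simp [size, funext_iff]

theorem le_size (μ : X → ℝ≥0) (x : X) : μ x ≤ size μ :=
  Finset.single_le_sum (f := μ) (fun _ _ => zero_le) (Finset.mem_univ x)

theorem continuous_size : Continuous (size : (X → ℝ≥0) → ℝ≥0) := by
  unfold size; fun_prop

@[simp] theorem dirac_self (x : X) : dirac x x = 1 := by simp [dirac]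

theorem dirac_apply (x y : X) : dirac x y = if y = x then 1 else 0 := by
  simp [dirac, Pi.single_apply]

theorem sum_smul_dirac (μ : X → ℝ≥0) : ∑ x, μ x • dirac x = μ := by
  ext y; simp [dirac_apply]

theorem push_apply (φ : X → Y) (ξ : X → ℝ≥0) : push φ ξ = ∑ x, ξ x • dirac (φ x) := rfl

@[simp] theorem push_dirac (φ : X → Y) (x : X) : push φ (dirac x) = dirac (φ x) := by
  simp [push_apply, dirac_apply]

@[simp] theorem push_push (ψ : Y → Z) (φ : X → Y) (ξ : X → ℝ≥0) :
    push ψ (push φ ξ) = push (ψ ∘ φ) ξ := by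
  simp [push_apply φ, push_apply (ψ ∘ φ), map_sum]

theorem push_id (ξ : X → ℝ≥0) : push id ξ = ξ := sum_smul_dirac ξ

@[simp] theorem size_push (φ : X → Y) (ξ : X → ℝ≥0) : size (push φ ξ) = size ξ := by
  rw [push_apply, size_sum]; simp [size_smul]; rfl

theorem push_eval (φ : X → Y) (ξ : X → ℝ≥0) (y : Y) :
    push φ ξ y = ∑ x, if φ x = y then ξ x else 0 := by
  simp [push_apply, Finset.sum_apply, dirac_apply, eq_comm]

theorem continuous_push (φ : X → Y) : Continuous (push φ : (X → ℝ≥0) → Y → ℝ≥0) := by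
  refine continuous_pi fun y => ?_
  simp only [push_eval]
  refine continuous_finsetSum _ fun x _ => ?_
  split_ifs
  · exact continuous_apply x
  · exact continuous_const

theorem isCompact_size_le (c : ℝ≥0) : IsCompact {μ : X → ℝ≥0 | size μ ≤ c} := by
  refine IsCompact.of_isClosed_subset
    (isCompact_univ_pi fun _ : X => isCompact_Icc (a := 0) (b := c))
    (isClosed_le continuous_size continuous_const) fun μ hμ x _ => ⟨zero_le, (le_size μ x).trans hμ⟩

theorem removeState_add (μ : X → ℝ≥0) (x : X) : removeState μ x + μ x • dirac x = μ := by
  ext y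
  rcases eq_or_ne y x with rfl | h <;> simp_all [removeState, dirac_apply]

/-! ### Flows -/

/-- `μ` is transformed into `γ` by using every transition `t ∈ P` a finite expected number `x t`
of times: the mass that enters a state is the mass that leaves it. -/
def MassFlow (P : Finset (X × (X → ℝ≥0))) (μ γ : X → ℝ≥0) : Prop :=
  ∃ x : X × (X → ℝ≥0) → ℝ≥0, μ + ∑ t ∈ P, x t • t.2 = γ + ∑ t ∈ P, x t • dirac t.1

namespace MassFlow

variable {P : Finset (X × (X → ℝ≥0))} {μ γ η μ' γ' : X → ℝ≥0}

theorem refl (μ : X → ℝ≥0) : MassFlow P μ μ := ⟨0, by simp⟩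

theorem trans (h : MassFlow P μ γ) (h' : MassFlow P γ η) : MassFlow P μ η := by
  obtain ⟨x, hx⟩ := h
  obtain ⟨y, hy⟩ := h'
  refine ⟨x + y, ?_⟩
  simp only [Pi.add_apply, add_smul, Finset.sum_add_distrib]
  rw [← add_assoc, hx, add_right_comm, hy]
  abel

theorem add (h : MassFlow P μ γ) (h' : MassFlow P μ' γ') : MassFlow P (μ + μ') (γ + γ') := by
  obtain ⟨x, hx⟩ := h
  obtain ⟨y, hy⟩ := h'
  refine ⟨x + y, ?_⟩
  simp only [Pi.add_apply, add_smul, Finset.sum_add_distrib]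
  rw [add_add_add_comm, hx, hy, add_add_add_comm]

theorem smul (c : ℝ≥0) (h : MassFlow P μ γ) : MassFlow P (c • μ) (c • γ) := by
  obtain ⟨x, hx⟩ := h
  refine ⟨c • x, ?_⟩
  simp only [Pi.smul_apply, smul_assoc, ← Finset.smul_sum, ← smul_add, hx]

theorem sum {ι : Type*} (s : Finset ι) {f g : ι → X → ℝ≥0} (h : ∀ i ∈ s, MassFlow P (f i) (g i)) :
    MassFlow P (∑ i ∈ s, f i) (∑ i ∈ s, g i) := by
  classical
  induction s using Finset.induction_on with
  | empty => simpa using refl 0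
  | insert a s ha ih =>
    rw [Finset.sum_insert ha, Finset.sum_insert ha]
    exact (h a (by simp)).add (ih fun i hi => h i (by simp [hi]))

theorem step {t : X × (X → ℝ≥0)} (ht : t ∈ P) : MassFlow P (dirac t.1) t.2 :=
  ⟨fun u => if u = t then 1 else 0, by simp [ite_smul, ht, add_comm]⟩

theorem size_eq (hP : ∀ t ∈ P, size t.2 = 1) (h : MassFlow P μ γ) : size μ = size γ := by
  obtain ⟨x, hx⟩ := h
  have := congrArg size hx
  simp only [size_add, size_sum, size_smul, size_dirac] at this
  rw [Finset.sum_congr rfl fun t ht => by rw [hP t ht]] at this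
  exact add_right_cancel this

/-- Flows are transported along maps of states that send transitions to transitions. -/
theorem map {Q : Finset (Y × (Y → ℝ≥0))} (φ : X → Y)
    (hφ : ∀ t ∈ P, (φ t.1, push φ t.2) ∈ Q) (h : MassFlow P μ γ) :
    MassFlow Q (push φ μ) (push φ γ) := by
  obtain ⟨x, hx⟩ := h
  have hstep : ∀ t ∈ P, MassFlow Q (dirac (φ t.1)) (push φ t.2) := fun t ht => step (hφ t ht)
  have hsum := MassFlow.sum P fun t ht => (hstep t ht).smul (x t)
  obtain ⟨y, hy⟩ := hsum
  refine ⟨y, ?_⟩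
  have hx' := congrArg (push φ) hx
  simp only [map_add, map_sum, map_smul, push_dirac] at hx'
  -- cancel the pushed inflow, which both sides contain
  have key : (push φ μ + ∑ t ∈ Q, y t • t.2) + ∑ t ∈ P, x t • push φ t.2 =
      (push φ γ + ∑ t ∈ Q, y t • dirac t.1) + ∑ t ∈ P, x t • push φ t.2 := by
    rw [add_right_comm, hx', add_assoc, hy, add_right_comm, add_assoc]
  exact add_right_cancel key

theorem isClosed_of_coe {A : Set (X → ℝ)} (hA : IsClosed A) :
    IsClosed {p : (X → ℝ≥0) × (X → ℝ≥0) | (fun x => (p.2 x : ℝ) - p.1 x) ∈ A} :=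
  hA.preimage (by fun_prop)

/-- The differences `γ - μ` form a finitely generated cone. -/
theorem isClosed (P : Finset (X × (X → ℝ≥0))) :
    IsClosed {p : (X → ℝ≥0) × (X → ℝ≥0) | MassFlow P p.1 p.2} := by
  convert isClosed_of_coe (isClosed_cone_of_finset
    (fun (t : X × (X → ℝ≥0)) (y : X) => ((t.2 y : ℝ) - (dirac t.1 y : ℝ≥0))) P) using 1
  ext ⟨μ, γ⟩
  simp only [Set.mem_ofPred_eq, MassFlow, funext_iff]
  constructor
  · rintro ⟨x, hx⟩
    refine ⟨fun t => x t, fun t _ => (x t).2, fun y => ?_⟩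
    have := congrArg ((↑) : ℝ≥0 → ℝ) (hx y)
    simp only [Pi.add_apply, Finset.sum_apply, Pi.smul_apply, smul_eq_mul, NNReal.coe_add,
      NNReal.coe_sum, NNReal.coe_mul] at this
    simp only [Finset.sum_apply, Pi.smul_apply, smul_eq_mul, mul_sub, Finset.sum_sub_distrib]
    linarith
  · rintro ⟨c, hc, h⟩
    refine ⟨fun t => (c t).toNNReal, fun y => NNReal.coe_injective ?_⟩
    have := h y
    simp only [Finset.sum_apply, Pi.smul_apply, smul_eq_mul, mul_sub,
      Finset.sum_sub_distrib] at this
    simp only [Pi.add_apply, Finset.sum_apply, Pi.smul_apply, smul_eq_mul, NNReal.coe_add,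
      NNReal.coe_sum, NNReal.coe_mul]
    have hco (f : X × (X → ℝ≥0) → ℝ) :
        ∑ t ∈ P, ((c t).toNNReal : ℝ) * f t = ∑ t ∈ P, c t * f t :=
      Finset.sum_congr rfl fun t ht => by rw [Real.coe_toNNReal _ (hc t ht)]
    rw [hco, hco]
    linarith

end MassFlow

end Mass

/-! ### Randomized memoryless policies -/

section Policy

variable {X : Type*} [Fintype X] [DecidableEq X]

/-- A randomized memoryless policy: in state `x` it stops with probability `halt x` and uses the
transition `t ∈ P` with `t.1 = x` with probability `use t`. -/
structure Policy (P : Finset (X × (X → ℝ≥0))) where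
  halt : X → ℝ≥0
  use : X × (X → ℝ≥0) → ℝ≥0
  halt_add_use : ∀ x, halt x + ∑ t ∈ P with t.1 = x, use t = 1

namespace Policy

variable {P : Finset (X × (X → ℝ≥0))} (p : Policy P)

/-- The mass after one more step; the mass that stops disappears. -/
def advance : (X → ℝ≥0) →ₗ[ℝ≥0] (X → ℝ≥0) where
  toFun ξ := ∑ t ∈ P, (ξ t.1 * p.use t) • t.2
  map_add' ξ ξ' := by simp [add_mul, add_smul, Finset.sum_add_distrib]
  map_smul' c ξ := by simp [mul_assoc, Finset.smul_sum, smul_smul]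

theorem advance_apply (ξ : X → ℝ≥0) : p.advance ξ = ∑ t ∈ P, (ξ t.1 * p.use t) • t.2 := rfl

theorem halt_add_moves (ξ : X → ℝ≥0) :
    ξ * p.halt + ∑ t ∈ P, (ξ t.1 * p.use t) • dirac t.1 = ξ := by
  ext x
  have h : ∑ t ∈ P, ξ t.1 * p.use t * (dirac t.1 x : ℝ≥0) =
      ξ x * ∑ t ∈ P with t.1 = x, p.use t := by
    rw [Finset.mul_sum, Finset.sum_filter]
    refine Finset.sum_congr rfl fun t _ => ?_
    rcases eq_or_ne t.1 x with h | h
    · subst h; simp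
    · simp [h, h.symm, dirac_apply]
  simp only [Pi.add_apply, Pi.mul_apply, Finset.sum_apply, Pi.smul_apply, smul_eq_mul]
  rw [h, ← mul_add, p.halt_add_use, mul_one]

theorem size_halt_add_advance (hP : ∀ t ∈ P, size t.2 = 1) (ξ : X → ℝ≥0) :
    size (ξ * p.halt) + size (p.advance ξ) = size ξ := by
  conv_rhs => rw [← p.halt_add_moves ξ]
  rw [size_add, advance_apply, size_sum, size_sum]
  congr 1
  exact Finset.sum_congr rfl fun t ht => by simp [size_smul, hP t ht]

/-- The mass that has stopped after at most `n` steps. -/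
def stopped (μ : X → ℝ≥0) (n : ℕ) : X → ℝ≥0 :=
  ∑ k ∈ Finset.range n, (p.advance ^ k) μ * p.halt

theorem stopped_succ (μ : X → ℝ≥0) (n : ℕ) :
    p.stopped μ (n + 1) = p.stopped μ n + (p.advance ^ n) μ * p.halt :=
  Finset.sum_range_succ _ n

theorem size_stopped_add (hP : ∀ t ∈ P, size t.2 = 1) (μ : X → ℝ≥0) (n : ℕ) :
    size (p.stopped μ n) + size ((p.advance ^ n) μ) = size μ := by
  induction n with
  | zero => simp [stopped]
  | succ n ih =>
    rw [stopped_succ, size_add, add_assoc, pow_succ', Module.End.mul_apply,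
      p.size_halt_add_advance hP, ih]

end Policy

open Filter Topology in
/-- A flow is realized by a randomized memoryless policy, which divides the mass present in each
state in proportion to its uses in the flow. The mass ever present in a state is at most the
throughput of the flow; so the moving mass dies out, and the stopped mass increases to `γ`. -/
theorem MassFlow.exists_policy {P : Finset (X × (X → ℝ≥0))} (hP : ∀ t ∈ P, size t.2 = 1)
    {μ γ : X → ℝ≥0} (h : MassFlow P μ γ) :
    ∃ p : Policy P, Tendsto (p.stopped μ) atTop (𝓝 γ) ∧
      Tendsto (fun n => (p.advance ^ n) μ) atTop (𝓝 0) := by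
  have hsize := h.size_eq hP
  obtain ⟨x, hx⟩ := h
  set y : X → ℝ≥0 := γ + ∑ t ∈ P, x t • dirac t.1 with hy
  have hyx (s : X) : y s = γ s + ∑ t ∈ P with t.1 = s, x t := by
    simp only [hy, Pi.add_apply, Finset.sum_apply, Pi.smul_apply, smul_eq_mul, Finset.sum_filter]
    congr 1
    refine Finset.sum_congr rfl fun t _ => ?_
    rcases eq_or_ne t.1 s with h | h
    · subst h; simp
    · simp [h, h.symm, dirac_apply]
  let p : Policy P :=
    { halt := fun s => if y s = 0 then 1 else γ s / y s
      use := fun t => x t / y t.1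
      halt_add_use := by
        intro s
        have : ∑ t ∈ P with t.1 = s, x t / y t.1 = (∑ t ∈ P with t.1 = s, x t) / y s := by
          rw [Finset.sum_div]
          exact Finset.sum_congr rfl fun t ht => by rw [(Finset.mem_filter.mp ht).2]
        rw [this]
        split_ifs with h
        · simp [h]
        · rw [← add_div, ← hyx, div_self h] }
  have hhalt (s : X) : y s * p.halt s = γ s := by
    simp only [p]
    split_ifs with h
    · have := hyx s
      rw [h] at this
      rw [h, zero_mul]
      exact (add_eq_zero.mp this.symm).1.symm
    · rw [mul_div_cancel₀ _ h]
  have huse (t : X × (X → ℝ≥0)) : y t.1 * p.use t ≤ x t := by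
    simp only [p]
    rcases eq_or_ne (y t.1) 0 with h | h
    · simp [h]
    · rw [mul_div_cancel₀ _ h]
  let M : ℕ → X → ℝ≥0 := fun n => ∑ k ∈ Finset.range n, (p.advance ^ k) μ
  have hMsucc (n : ℕ) : M (n + 1) = μ + p.advance (M n) := by
    simp only [M, Finset.sum_range_succ', map_sum, pow_zero, Module.End.one_apply]
    rw [add_comm]
    simp only [pow_succ', Module.End.mul_apply]
  have hM (n : ℕ) : M n ≤ y := by
    induction n with
    | zero => intro s; simp [M]
    | succ n ih =>
      rw [hMsucc, ← hx, Policy.advance_apply]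
      refine add_le_add_right (Finset.sum_le_sum fun t _ s => ?_) _
      simp only [Pi.smul_apply, smul_eq_mul]
      exact mul_le_mul_left ((mul_le_mul_left (ih t.1) _).trans (huse t)) _
  have hm : Tendsto (fun n => (p.advance ^ n) μ) atTop (𝓝 0) := by
    refine tendsto_pi_nhds.mpr fun s => ?_
    have : Summable fun n => (p.advance ^ n) μ s :=
      NNReal.summable_of_sum_range_le (c := y s) fun n => by
        simpa [M, Finset.sum_apply] using hM n s
    exact NNReal.tendsto_atTop_zero_of_summable this
  have hD (n : ℕ) : p.stopped μ n ≤ γ := by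
    intro s
    have : p.stopped μ n s = M n s * p.halt s := by
      simp [Policy.stopped, M, Finset.sum_apply, Finset.sum_mul]
    rw [this, ← hhalt s]
    exact mul_le_mul_left (hM n s) _
  refine ⟨p, tendsto_pi_nhds.mpr fun s => ?_, hm⟩
  -- what is missing at `s` is at most what is still moving
  have hgap (n : ℕ) : γ s ≤ p.stopped μ n s + size ((p.advance ^ n) μ) := by
    have h1 : size (p.stopped μ n) + size (γ - p.stopped μ n) = size γ := by
      rw [← size_add, add_tsub_cancel_of_le (hD n)]
    have h2 := p.size_stopped_add hP μ n
    rw [hsize, ← h1] at h2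
    rw [add_left_cancel h2]
    calc γ s = p.stopped μ n s + (γ - p.stopped μ n) s := by
          rw [← Pi.add_apply, add_tsub_cancel_of_le (hD n)]
      _ ≤ _ := add_le_add_right (le_size _ s) _
  have hz : Tendsto (fun n => size ((p.advance ^ n) μ)) atTop (𝓝 0) := by
    simpa [Function.comp_def] using (continuous_size.tendsto 0).comp hm
  have hlow : Tendsto (fun n => γ s - size ((p.advance ^ n) μ)) atTop (𝓝 (γ s)) := by
    simpa using (tendsto_const_nhds (x := γ s)).sub hz
  exact tendsto_of_tendsto_of_tendsto_of_le_of_le hlow tendsto_const_nhds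
    (fun n => tsub_le_iff_right.mpr (hgap n)) fun n => hD n s

open Filter Topology in
/-- Induction along a flow: what is preserved by moving any amount of mass along a single
transition, and by limits, is preserved by a flow. -/
theorem MassFlow.induction_closed {P : Finset (X × (X → ℝ≥0))} (hP : ∀ t ∈ P, size t.2 = 1)
    {A : Set (X → ℝ≥0)} (hA : IsClosed A)
    (hstep : ∀ t ∈ P, ∀ (ρ : X → ℝ≥0) (w : ℝ≥0), ρ + w • dirac t.1 ∈ A → ρ + w • t.2 ∈ A)
    {μ γ : X → ℝ≥0} (hμ : μ ∈ A) (h : MassFlow P μ γ) : γ ∈ A := by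
  obtain ⟨p, hp, hp0⟩ := h.exists_policy hP
  have hsteps : ∀ (Q : Finset (X × (X → ℝ≥0))), Q ⊆ P → ∀ (ρ : X → ℝ≥0)
      (w : X × (X → ℝ≥0) → ℝ≥0), ρ + ∑ t ∈ Q, w t • dirac t.1 ∈ A →
      ρ + ∑ t ∈ Q, w t • t.2 ∈ A := by
    classical
    intro Q
    induction Q using Finset.induction_on with
    | empty => simp
    | insert t Q ht ih =>
      intro hQ ρ w hA
      rw [Finset.sum_insert ht] at hA ⊢
      rw [← add_assoc]
      refine ih (fun u hu => hQ (by simp [hu])) _ _ ?_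
      rw [add_right_comm]
      refine hstep t (hQ (by simp)) _ _ ?_
      rwa [add_assoc, add_comm (Finset.sum _ _)]
  have hn (n : ℕ) : p.stopped μ n + (p.advance ^ n) μ ∈ A := by
    induction n with
    | zero => simpa [Policy.stopped] using hμ
    | succ n ih =>
      rw [p.stopped_succ, pow_succ', Module.End.mul_apply, Policy.advance_apply]
      refine hsteps P subset_rfl _ _ ?_
      rwa [add_assoc, p.halt_add_moves]
  have hlim : Tendsto (fun n => p.stopped μ n + (p.advance ^ n) μ) atTop (𝓝 γ) := by
    simpa using hp.add hp0
  exact hA.mem_of_tendsto hlim (Eventually.of_forall hn)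

end Policy

/-! ### Levels of a tree -/

namespace LabelledTree

variable {L : Type*} (T : LabelledTree L)

/-- The nodes of depth `n`. -/
noncomputable def level : ℕ → Finset (List ℕ)
  | 0 => {[]}
  | n + 1 => (level n).biUnion fun σ => (T.children σ).image fun i => σ ++ [i]

theorem mem_children {σ : List ℕ} {i : ℕ} : i ∈ T.children σ ↔ σ ++ [i] ∈ T.nodes := by
  simp [children]

theorem mem_level {n : ℕ} {σ : List ℕ} : σ ∈ T.level n ↔ σ ∈ T.nodes ∧ σ.length = n := by
  induction n generalizing σ with
  | zero =>
    simp only [level, Finset.mem_singleton, List.length_eq_zero_iff]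
    exact ⟨fun h => ⟨h ▸ T.root_mem, h⟩, fun h => h.2⟩
  | succ n ih =>
    simp only [level, Finset.mem_biUnion, Finset.mem_image, mem_children]
    constructor
    · rintro ⟨ρ, hρ, i, hi, rfl⟩
      exact ⟨hi, by simp [(ih.mp hρ).2]⟩
    · rintro ⟨hσ, hlen⟩
      rcases List.eq_nil_or_concat σ with rfl | ⟨ρ, i, rfl⟩
      · simp at hlen
      · rw [List.concat_eq_append] at hσ ⊢
        exact ⟨ρ, ih.mpr ⟨T.prefix_mem _ _ hσ (List.prefix_append _ _), by simpa using hlen⟩,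
          i, hσ, rfl⟩

theorem sum_level_succ {M : Type*} [AddCommMonoid M] (f : List ℕ → M) (n : ℕ) :
    ∑ σ ∈ T.level (n + 1), f σ = ∑ σ ∈ T.level n, ∑ i ∈ T.children σ, f (σ ++ [i]) := by
  rw [level, Finset.sum_biUnion]
  · refine Finset.sum_congr rfl fun σ _ => Finset.sum_image fun i _ j _ h => ?_
    simpa using h
  · intro σ _ ρ _ hne
    rw [Function.onFun, Finset.disjoint_left]
    intro τ h₁ h₂
    obtain ⟨i, _, rfl⟩ := Finset.mem_image.mp h₁
    obtain ⟨j, _, h⟩ := Finset.mem_image.mp h₂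
    exact hne (List.append_inj_left' h rfl).symm

theorem mem_leaves_iff {σ : List ℕ} : σ ∈ T.leaves ↔ σ ∈ T.nodes ∧ T.children σ = ∅ := by
  simp only [leaves, Set.mem_ofPred_eq, and_congr_right_iff]
  intro _
  rw [Finset.eq_empty_iff_forall_notMem]
  constructor
  · intro h i hi
    exact h ⟨_, T.mem_children.mp hi, List.prefix_append _ _, by simp⟩
  · rintro h ⟨σ', hσ', ⟨τ, rfl⟩, hne⟩
    cases τ with
    | nil => simp at hne
    | cons i τ =>
      refine h i (T.mem_children.mpr (T.prefix_mem _ _ hσ' ⟨τ, by simp⟩))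

open Classical in
/-- The leaves of depth less than `n`, as a finite set of leaves. -/
noncomputable def leavesBelow (n : ℕ) : Finset T.leaves :=
  ((Finset.range n).biUnion fun k => T.level k).subtype (· ∈ T.leaves)

theorem mem_leavesBelow {n : ℕ} {σ : T.leaves} :
    σ ∈ T.leavesBelow n ↔ (σ : List ℕ).length < n := by
  simp only [leavesBelow, Finset.mem_subtype, Finset.mem_biUnion, Finset.mem_range, mem_level]
  constructor
  · rintro ⟨k, hk, -, rfl⟩; exact hk
  · exact fun h => ⟨_, h, σ.2.1, rfl⟩

open Filter in
theorem tendsto_leavesBelow : Tendsto T.leavesBelow atTop atTop := by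
  refine tendsto_atTop_finset_of_monotone (fun m n h σ => ?_) fun σ => ⟨_, T.mem_leavesBelow.mpr
    (Nat.lt_succ_self _)⟩
  simp only [mem_leavesBelow]
  exact fun hσ => hσ.trans_le h

open Classical in
theorem sum_leavesBelow_succ {M : Type*} [AddCommMonoid M] (f : List ℕ → M) (n : ℕ) :
    ∑ σ ∈ T.leavesBelow (n + 1), f σ =
      ∑ σ ∈ T.leavesBelow n, f σ + ∑ σ ∈ T.level n with σ ∈ T.leaves, f σ := by
  have h (n : ℕ) : ∑ σ ∈ T.leavesBelow n, f σ =
      ∑ k ∈ Finset.range n, ∑ σ ∈ T.level k with σ ∈ T.leaves, f σ := by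
    rw [leavesBelow, Finset.sum_subtype_eq_sum_filter, ← Finset.sum_biUnion]
    · congr 1; ext σ; simp [← exists_and_right, and_assoc]
    · intro i _ j _ hij
      rw [Function.onFun, Finset.disjoint_left]
      intro σ h₁ h₂
      simp only [Finset.mem_filter, mem_level] at h₁ h₂
      exact hij (h₁.1.2.symm.trans h₂.1.2)
  rw [h, h, Finset.sum_range_succ]

end LabelledTree

/-! ### Flows from trees -/

section TreeFlow

variable {L X : Type*} [Fintype X] [DecidableEq X]

/-- `T`, with the mass `prob σ` placed on the state `pos σ` at every node `σ`, unfolds transitions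
of `P`. -/
structure IsUnfolding (P : Finset (X × (X → ℝ≥0))) (T : LabelledTree L) (pos : List ℕ → X)
    (prob : List ℕ → ℝ≥0) : Prop where
  root : prob [] = 1
  inner : ∀ σ ∈ T.inner, ∃ t ∈ P, t.1 = pos σ ∧
    prob σ • t.2 = ∑ i ∈ T.children σ, prob (σ ++ [i]) • dirac (pos (σ ++ [i]))

namespace IsUnfolding

variable {P : Finset (X × (X → ℝ≥0))} {T : LabelledTree L} {pos : List ℕ → X}
  {prob : List ℕ → ℝ≥0}

/-- Cutting the tree at depth `n` gives a finite flow. -/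
theorem massFlow_cut (h : IsUnfolding P T pos prob) (n : ℕ) :
    MassFlow P (dirac (pos []))
      (∑ σ ∈ T.leavesBelow n, prob σ • dirac (pos σ) +
        ∑ σ ∈ T.level n, prob σ • dirac (pos σ)) := by
  classical
  induction n with
  | zero =>
    have : T.leavesBelow 0 = ∅ := by
      ext σ; simp [LabelledTree.mem_leavesBelow]
    simpa [this, LabelledTree.level, h.root] using MassFlow.refl (dirac (pos []))
  | succ n ih =>
    refine ih.trans ?_
    rw [T.sum_leavesBelow_succ (fun σ => prob σ • dirac (pos σ)), T.sum_level_succ, add_assoc]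
    refine (MassFlow.refl _).add ?_
    rw [Finset.sum_filter, ← Finset.sum_add_distrib]
    refine MassFlow.sum _ fun σ hσ => ?_
    by_cases hl : σ ∈ T.leaves
    · simpa [hl, (T.mem_leaves_iff.mp hl).2] using MassFlow.refl _
    · obtain ⟨t, ht, hpos, hsum⟩ := h.inner σ ⟨(T.mem_level.mp hσ).1, hl⟩
      rw [if_neg hl, zero_add, ← hsum, ← hpos]
      exact (MassFlow.step ht).smul _

theorem size_leavesBelow_add (h : IsUnfolding P T pos prob) (hP : ∀ t ∈ P, size t.2 = 1) (n : ℕ) :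
    ∑ σ ∈ T.leavesBelow n, prob σ + ∑ σ ∈ T.level n, prob σ = 1 := by
  have := (h.massFlow_cut n).size_eq hP
  simpa [size_add, size_sum, size_smul] using this.symm

open Filter Topology in
theorem size_le_one (h : IsUnfolding P T pos prob) (hP : ∀ t ∈ P, size t.2 = 1) {ν : X → ℝ≥0}
    (hν : HasSum (fun σ : T.leaves => prob σ • dirac (pos σ)) ν) : size ν ≤ 1 := by
  have hlim := (continuous_size.tendsto ν).comp (hν.comp T.tendsto_leavesBelow)
  refine le_of_tendsto hlim (Eventually.of_forall fun n => ?_)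
  rw [← h.size_leavesBelow_add hP n]
  simp [size_sum, size_smul]

open Filter Topology in
/-- If no mass is lost along infinite paths, then the mass moving at depth `n` tends to `0`, and
the cuts converge to the outcome of the tree. -/
theorem massFlow (h : IsUnfolding P T pos prob) (hP : ∀ t ∈ P, size t.2 = 1) {ν : X → ℝ≥0}
    (hν : HasSum (fun σ : T.leaves => prob σ • dirac (pos σ)) ν) (hsize : size ν = 1) :
    MassFlow P (dirac (pos [])) ν := by
  set D : ℕ → X → ℝ≥0 := fun n => ∑ σ ∈ T.leavesBelow n, prob σ • dirac (pos σ)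
  set R : ℕ → X → ℝ≥0 := fun n => ∑ σ ∈ T.level n, prob σ • dirac (pos σ)
  have hD : Tendsto D atTop (𝓝 ν) := hν.comp T.tendsto_leavesBelow
  have hsz (n : ℕ) : size (R n) = 1 - size (D n) := by
    refine (tsub_eq_of_eq_add ?_).symm
    have := (h.massFlow_cut n).size_eq hP
    rw [size_dirac, size_add, add_comm] at this
    exact this
  have hR0 : Tendsto (fun n => size (R n)) atTop (𝓝 0) := by
    have : Tendsto (fun n => 1 - size (D n)) atTop (𝓝 (1 - size ν)) :=
      tendsto_const_nhds.sub ((continuous_size.tendsto ν).comp hD)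
    simpa [hsz, hsize] using this
  have hR : Tendsto R atTop (𝓝 0) := tendsto_pi_nhds.mpr fun x =>
    tendsto_of_tendsto_of_tendsto_of_le_of_le tendsto_const_nhds hR0 (fun _ => zero_le)
      fun n => le_size _ x
  have hlim : Tendsto (fun n => (dirac (pos []), D n + R n)) atTop
      (𝓝 ((dirac (pos []) : X → ℝ≥0), ν)) := by
    refine tendsto_const_nhds.prodMk_nhds ?_
    simpa using hD.add hR
  exact (MassFlow.isClosed P).mem_of_tendsto hlim (Eventually.of_forall h.massFlow_cut)

/-- The finite sums over leaves are bounded by the mass of the root. -/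
theorem summable (h : IsUnfolding P T pos prob) (hP : ∀ t ∈ P, size t.2 = 1) :
    Summable fun σ : T.leaves => prob σ • (dirac (pos σ) : X → ℝ≥0) := by
  refine Pi.summable.mpr fun x => NNReal.summable_of_le (f := fun σ : T.leaves => prob σ)
    (fun σ => ?_) ?_
  · simp only [Pi.smul_apply, smul_eq_mul, dirac_apply]
    split_ifs <;> simp
  · refine NNReal.summable_coe.mp <| summable_of_sum_le (c := 1) (fun σ => (prob σ).2)
      fun s => ?_
    obtain ⟨n, hn⟩ := (Filter.tendsto_atTop.mp T.tendsto_leavesBelow s).exists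
    norm_cast
    calc ∑ σ ∈ s, prob σ ≤ ∑ σ ∈ T.leavesBelow n, prob σ := Finset.sum_le_sum_of_subset hn
      _ ≤ 1 := by rw [← h.size_leavesBelow_add hP n]; exact le_self_add

end IsUnfolding

end TreeFlow

/-! ### Unfolding a finitely branching system into a tree -/

section Unfold

variable {N L : Type*}

/-- Follow the path `σ` from `root`, choosing successors by their position in the list `kids`. -/
def walk (kids : N → List N) (root : N) (σ : List ℕ) : Option N :=
  σ.foldl (fun o i => o.bind fun n => (kids n)[i]?) (some root)

theorem walk_append (kids : N → List N) (root : N) (σ : List ℕ) (i : ℕ) :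
    walk kids root (σ ++ [i]) = (walk kids root σ).bind fun n => (kids n)[i]? := by
  simp [walk]

theorem isSome_walk_of_append (kids : N → List N) (root : N) (σ τ : List ℕ)
    (h : (walk kids root (σ ++ τ)).isSome) : (walk kids root σ).isSome := by
  induction τ using List.reverseRecOn with
  | nil => simpa using h
  | append_singleton τ i ih =>
    refine ih ?_
    rw [← List.append_assoc, walk_append] at h
    exact Option.isSome_of_isSome_bind h

/-- The tree of all paths from `root`; the node reached by a path is labelled by `lab`. -/
def unfoldTree (kids : N → List N) (root : N) (lab : N → L) : LabelledTree L where
  nodes := {σ | (walk kids root σ).isSome}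
  label σ := lab ((walk kids root σ).getD root)
  prefix_mem := by
    rintro σ _ h ⟨τ, rfl⟩
    exact isSome_walk_of_append kids root σ τ h
  sibling_mem := by
    intro σ i h
    simp only [Set.mem_ofPred_eq, walk_append] at h ⊢
    cases hw : walk kids root σ with
    | none => simp [hw] at h
    | some n =>
      simp only [hw, Option.bind_some, isSome_getElem?] at h ⊢
      omega
  root_mem := by simp [walk]
  finite_branching := by
    intro σ
    cases hw : walk kids root σ with
    | none => simp [walk_append, hw]
    | some n =>
      refine (Set.finite_lt_nat (kids n).length).subset fun i hi => ?_
      simpa [walk_append, hw] using hi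

variable (kids : N → List N) (root : N) (lab : N → L)

theorem mem_nodes_unfoldTree {σ : List ℕ} :
    σ ∈ (unfoldTree kids root lab).nodes ↔ ∃ n, walk kids root σ = some n :=
  Option.isSome_iff_exists

theorem label_unfoldTree {σ : List ℕ} {n : N} (h : walk kids root σ = some n) :
    (unfoldTree kids root lab).label σ = lab n := by
  simp [unfoldTree, h]

theorem children_unfoldTree {σ : List ℕ} {n : N} (h : walk kids root σ = some n) :
    (unfoldTree kids root lab).children σ = Finset.range (kids n).length := by
  ext i
  simp [LabelledTree.mem_children, unfoldTree, walk_append, h]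

theorem sum_children_unfoldTree {M : Type*} [AddCommMonoid M] {σ : List ℕ} {n : N}
    (h : walk kids root σ = some n) (f : N → M) :
    ∑ i ∈ (unfoldTree kids root lab).children σ, f ((walk kids root (σ ++ [i])).getD root) =
      ((kids n).map f).sum := by
  rw [children_unfoldTree kids root lab h, ← Fin.sum_univ_fun_getElem, ← Fin.sum_univ_eq_sum_range
    (fun i => f ((walk kids root (σ ++ [i])).getD root))]
  refine Finset.sum_congr rfl fun i _ => ?_
  have hi : walk kids root (σ ++ [(i : ℕ)]) = some (kids n)[i] := by simp [walk_append, h]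
  rw [hi]
  rfl

theorem mem_leaves_unfoldTree {σ : List ℕ} :
    σ ∈ (unfoldTree kids root lab).leaves ↔ ∃ n, walk kids root σ = some n ∧ kids n = [] := by
  rw [LabelledTree.mem_leaves_iff, mem_nodes_unfoldTree]
  constructor
  · rintro ⟨⟨n, hn⟩, h⟩
    refine ⟨n, hn, ?_⟩
    rw [children_unfoldTree kids root lab hn] at h
    simpa using h
  · rintro ⟨n, hn, h⟩
    refine ⟨⟨n, hn⟩, ?_⟩
    rw [children_unfoldTree kids root lab hn]
    simp [h]

end Unfold

/-! ### Trees from policies -/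

/-- Replace the labels of a tree. -/
def LabelledTree.mapLabel {L L' : Type*} (f : L → L') (T : LabelledTree L) : LabelledTree L' :=
  { T with label := fun σ => f (T.label σ) }

section PolicyTree

variable {X : Type*} [Fintype X] [DecidableEq X] {P : Finset (X × (X → ℝ≥0))}

/-- The label of a node: its state, its probability and the transition used there (`none` at
the leaves). -/
abbrev PathLabel (X : Type*) : Type _ := X × ℝ≥0 × Option (X × (X → ℝ≥0))

/-- A tree of transitions of `P` in which every node has positive probability and carries the
transition used there. -/
structure IsPathTree (P : Finset (X × (X → ℝ≥0))) (T : LabelledTree (PathLabel X)) : Prop where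
  root : (T.label []).2.1 = 1
  pos : ∀ σ ∈ T.nodes, 0 < (T.label σ).2.1
  leaf : ∀ σ ∈ T.leaves, (T.label σ).2.2 = none
  inner : ∀ σ ∈ T.inner, ∃ t ∈ P, (T.label σ).2.2 = some t ∧ t.1 = (T.label σ).1 ∧
    (T.label σ).2.1 • t.2 =
      ∑ i ∈ T.children σ, (T.label (σ ++ [i])).2.1 • dirac (T.label (σ ++ [i])).1

theorem IsPathTree.isUnfolding {T : LabelledTree (PathLabel X)} (h : IsPathTree P T) :
    IsUnfolding P T (fun σ => (T.label σ).1) fun σ => (T.label σ).2.1 :=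
  ⟨h.root, fun σ hσ => by
    obtain ⟨t, ht, -, h1, h2⟩ := h.inner σ hσ
    exact ⟨t, ht, h1, h2⟩⟩

namespace Policy

variable (p : Policy P)

/-- The probability of a decision in state `x`: to stop (`none`) or to use a transition. A pair of a
state and a decision is called a decided state below; its next step is deterministic. -/
def choose (x : X) : Option P → ℝ≥0
  | none => p.halt x
  | some t => if (t : X × (X → ℝ≥0)).1 = x then p.use t else 0

theorem sum_choose (x : X) : ∑ a, p.choose x a = 1 := by
  rw [Fintype.sum_option, ← p.halt_add_use x, Finset.sum_filter, ← Finset.sum_coe_sort P]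
  rfl

/-- The mass that a decided state sends to each decided state, when the successors make their
decisions at once. -/
def send : X × Option P → X × Option P → ℝ≥0
  | (_, none), _ => 0
  | (_, some t), (x', a') => (t : X × (X → ℝ≥0)).2 x' * p.choose x' a'

/-- `send` as a linear map on mass functions of decided states. -/
def sendAll : (X × Option P → ℝ≥0) →ₗ[ℝ≥0] (X × Option P → ℝ≥0) where
  toFun ξ := ∑ y, ξ y • p.send y
  map_add' ξ ξ' := by simp [add_smul, Finset.sum_add_distrib]
  map_smul' c ξ := by simp [Finset.smul_sum, smul_smul]

theorem sendAll_apply (ξ : X × Option P → ℝ≥0) : p.sendAll ξ = ∑ y, ξ y • p.send y := rfl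

/-- The mass function of decided states when all states make their decisions. -/
def decided (ξ : X → ℝ≥0) : X × Option P → ℝ≥0 := fun y => ξ y.1 * p.choose y.1 y.2

theorem sendAll_decided (ξ : X → ℝ≥0) : p.sendAll (p.decided ξ) = p.decided (p.advance ξ) := by
  refine funext fun ⟨x', a'⟩ => ?_
  change (p.sendAll (p.decided ξ)) (x', a') = p.advance ξ x' * p.choose x' a'
  simp only [sendAll_apply, decided, advance_apply, Finset.sum_apply, Pi.smul_apply, smul_eq_mul,
    Finset.sum_mul, Fintype.sum_prod_type, Fintype.sum_option, send, mul_zero, zero_add]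
  rw [Finset.sum_comm, ← Finset.sum_coe_sort P]
  refine Finset.sum_congr rfl fun t _ => ?_
  simp [choose, mul_assoc]

theorem sendAll_pow_decided (ξ : X → ℝ≥0) (n : ℕ) :
    (p.sendAll ^ n) (p.decided ξ) = p.decided ((p.advance ^ n) ξ) := by
  induction n with
  | zero => simp
  | succ n ih => simp only [pow_succ', Module.End.mul_apply, ih, sendAll_decided]

/-- The successors of a decided state that is reached with a given probability. Only those of
positive probability are listed. -/
noncomputable def kids (n : (X × Option P) × ℝ≥0) : List ((X × Option P) × ℝ≥0) :=
  open Classical in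
  (Finset.univ.filter fun y => p.send n.1 y ≠ 0).toList.map fun y => (y, n.2 * p.send n.1 y)

/-- The label of a decided state in the tree. -/
def nodeLabel (n : (X × Option P) × ℝ≥0) : PathLabel X := (n.1.1, n.2, n.1.2.map Subtype.val)

/-- The tree of the policy from a decided state. -/
noncomputable def tree (y : X × Option P) : LabelledTree (PathLabel X) :=
  unfoldTree p.kids (y, 1) nodeLabel

theorem sum_kids {M : Type*} [AddCommMonoid M] (n : (X × Option P) × ℝ≥0)
    (f : (X × Option P) × ℝ≥0 → M) (h0 : ∀ y, f (y, 0) = 0) :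
    ((p.kids n).map f).sum = ∑ y, f (y, n.2 * p.send n.1 y) := by
  classical
  rw [kids, List.map_map, Finset.sum_map_toList, Finset.sum_filter]
  refine Finset.sum_congr rfl fun y _ => ?_
  split_ifs with h
  · rfl
  · rw [not_not.mp h, mul_zero, h0]

theorem sum_send (hP : ∀ t ∈ P, size t.2 = 1) (x : X) (t : P) : ∑ y, p.send (x, some t) y = 1 := by
  simp only [send, Fintype.sum_prod_type, ← Finset.mul_sum, sum_choose, mul_one]
  exact hP t t.2

theorem kids_eq_nil_iff (hP : ∀ t ∈ P, size t.2 = 1) (n : (X × Option P) × ℝ≥0) :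
    p.kids n = [] ↔ n.1.2 = none := by
  rcases n with ⟨⟨x, a⟩, q⟩
  cases a with
  | none => simp [kids, send]
  | some t =>
    simp only [reduceCtorEq, iff_false]
    intro h
    have := p.sum_send hP x t
    rw [Finset.sum_eq_zero] at this
    · exact zero_ne_one this
    · intro y _
      simp only [kids, List.map_eq_nil_iff, Finset.toList_eq_nil] at h
      simpa using Finset.filter_eq_empty_iff.mp h (Finset.mem_univ y)

/-- Every node of the tree has positive probability, and its decision is one that its state can
make. -/
theorem walk_invariant (y : X × Option P) (hy : ∀ t, y.2 = some t → (t : X × (X → ℝ≥0)).1 = y.1)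
    {σ : List ℕ} {n : (X × Option P) × ℝ≥0} (h : walk p.kids (y, 1) σ = some n) :
    0 < n.2 ∧ ∀ t, n.1.2 = some t → (t : X × (X → ℝ≥0)).1 = n.1.1 := by
  induction σ using List.reverseRecOn generalizing n with
  | nil =>
    obtain rfl : (y, 1) = n := by simpa [walk] using h
    exact ⟨one_pos, hy⟩
  | append_singleton σ i ih =>
    rw [walk_append, Option.bind_eq_some_iff] at h
    obtain ⟨m, hm, h⟩ := h
    have hmem := List.mem_of_getElem? h
    simp only [kids, List.mem_map, Finset.mem_toList, Finset.mem_filter, Finset.mem_univ,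
      true_and] at hmem
    obtain ⟨⟨x', a'⟩, hz, rfl⟩ := hmem
    refine ⟨mul_pos (ih hm).1 (pos_iff_ne_zero.mpr hz), fun t ht => ?_⟩
    rcases m with ⟨⟨x, b⟩, q⟩
    obtain rfl : a' = some t := ht
    cases b with
    | none => simp [send] at hz
    | some u =>
      by_contra hne
      exact hz (by simp only [send, choose, if_neg hne, mul_zero])

theorem isPathTree_tree (hP : ∀ t ∈ P, size t.2 = 1) (y : X × Option P)
    (hy : ∀ t, y.2 = some t → (t : X × (X → ℝ≥0)).1 = y.1) : IsPathTree P (p.tree y) where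
  root := by rw [tree, label_unfoldTree _ _ _ (n := (y, 1)) (by simp [walk])]; rfl
  pos := by
    intro σ hσ
    obtain ⟨n, hn⟩ := (mem_nodes_unfoldTree _ _ _).mp hσ
    rw [tree, label_unfoldTree _ _ _ hn]
    exact (p.walk_invariant y hy hn).1
  leaf := by
    intro σ hσ
    obtain ⟨n, hn, hk⟩ := (mem_leaves_unfoldTree _ _ _).mp hσ
    rw [tree, label_unfoldTree _ _ _ hn, nodeLabel, (p.kids_eq_nil_iff hP n).mp hk]
    rfl
  inner := by
    rintro σ ⟨hσ, hl⟩
    obtain ⟨n, hn⟩ := (mem_nodes_unfoldTree _ _ _).mp hσ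
    have hk : n.1.2 ≠ none := fun h =>
      hl ((mem_leaves_unfoldTree _ _ _).mpr ⟨n, hn, (p.kids_eq_nil_iff hP n).mpr h⟩)
    obtain ⟨t, ht⟩ := Option.ne_none_iff_exists'.mp hk
    refine ⟨t, t.2, ?_, ?_, ?_⟩
    · rw [tree, label_unfoldTree _ _ _ hn, nodeLabel, ht]; rfl
    · rw [tree, label_unfoldTree _ _ _ hn]
      exact (p.walk_invariant y hy hn).2 t ht
    · refine Eq.trans ?_ (sum_children_unfoldTree _ _ _ hn fun m => m.2 • dirac m.1.1).symm
      rw [tree, label_unfoldTree _ _ _ hn, sum_kids _ _ _ (by simp)]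
      rcases n with ⟨⟨x, a⟩, q⟩
      obtain rfl : a = some t := ht
      simp only [nodeLabel, send, mul_smul, ← Finset.smul_sum, Fintype.sum_prod_type,
        ← Finset.sum_smul, sum_choose, one_smul]
      rw [sum_smul_dirac]

/-- The decided state, with its probability, at a node of the tree. -/
noncomputable def nodeAt (y : X × Option P) (σ : List ℕ) : (X × Option P) × ℝ≥0 :=
  (walk p.kids (y, 1) σ).getD (y, 1)

/-- The masses on the levels of the tree are the iterates of `sendAll`. -/
theorem sum_level_tree [DecidableEq (X × Option P)] (y : X × Option P) (n : ℕ) :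
    ∑ σ ∈ (p.tree y).level n, (p.nodeAt y σ).2 • dirac (p.nodeAt y σ).1 =
      (p.sendAll ^ n) (dirac y) := by
  induction n with
  | zero => simp [LabelledTree.level, nodeAt, walk]
  | succ n ih =>
    rw [LabelledTree.sum_level_succ, pow_succ', Module.End.mul_apply, ← ih, map_sum]
    refine Finset.sum_congr rfl fun σ hσ => ?_
    obtain ⟨m, hm⟩ := (mem_nodes_unfoldTree _ _ _).mp ((p.tree y).mem_level.mp hσ).1
    refine (sum_children_unfoldTree _ _ _ hm fun m => m.2 • dirac m.1).trans ?_
    rw [sum_kids _ _ _ (by simp), nodeAt, hm, Option.getD_some, map_smul]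
    simp only [mul_smul, ← Finset.smul_sum, sum_smul_dirac]
    congr 1
    simp [sendAll_apply, dirac_apply]

theorem sum_leavesBelow_tree [DecidableEq (X × Option P)] (hP : ∀ t ∈ P, size t.2 = 1)
    (y : X × Option P) (n : ℕ) :
    ∑ σ ∈ (p.tree y).leavesBelow n,
        ((p.tree y).label σ).2.1 • dirac ((p.tree y).label σ).1 =
      ∑ k ∈ Finset.range n,
        LinearMap.funLeft ℝ≥0 ℝ≥0 (fun x => (x, none)) ((p.sendAll ^ k) (dirac y)) := by
  classical
  induction n with
  | zero =>
    have : (p.tree y).leavesBelow 0 = ∅ := by ext σ; simp [LabelledTree.mem_leavesBelow]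
    simp [this]
  | succ n ih =>
    rw [LabelledTree.sum_leavesBelow_succ _ (fun σ => ((p.tree y).label σ).2.1 •
      dirac ((p.tree y).label σ).1), ih, Finset.sum_range_succ, ← p.sum_level_tree, map_sum,
      Finset.sum_filter]
    congr 1
    refine Finset.sum_congr rfl fun σ hσ => ?_
    obtain ⟨m, hm⟩ := (mem_nodes_unfoldTree _ _ _).mp ((p.tree y).mem_level.mp hσ).1
    have hl : σ ∈ (p.tree y).leaves ↔ m.1.2 = none := by
      rw [tree, mem_leaves_unfoldTree]
      simp [hm, p.kids_eq_nil_iff hP]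
    rw [tree, label_unfoldTree _ _ _ hm, nodeAt, hm, Option.getD_some, ← tree, map_smul]
    rcases m with ⟨⟨x, a⟩, q⟩
    ext z
    cases a with
    | none => simp [hl, nodeLabel, LinearMap.funLeft_apply, dirac_apply]
    | some t => simp [hl, LinearMap.funLeft_apply, dirac_apply]

/-- The trees from all decided states together stop the same mass as the policy. -/
theorem sum_decided_leavesBelow (hP : ∀ t ∈ P, size t.2 = 1) (μ : X → ℝ≥0) (n : ℕ) :
    ∑ y, p.decided μ y • ∑ σ ∈ (p.tree y).leavesBelow n,
        ((p.tree y).label σ).2.1 • dirac ((p.tree y).label σ).1 = p.stopped μ n := by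
  classical
  simp only [p.sum_leavesBelow_tree hP, Finset.smul_sum]
  rw [Finset.sum_comm, stopped]
  refine Finset.sum_congr rfl fun k _ => ?_
  simp only [← map_smul, ← map_sum]
  rw [sum_smul_dirac, sendAll_pow_decided]
  rfl

end Policy

open Filter Topology in
/-- A flow is a mixture of outcomes of trees: each state decides at random on a tree. -/
theorem MassFlow.exists_trees (hP : ∀ t ∈ P, size t.2 = 1) {μ γ : X → ℝ≥0}
    (h : MassFlow P μ γ) :
    ∃ (c : X → Option P → ℝ≥0) (ν : X → Option P → X → ℝ≥0),
      (∀ x, ∑ a, c x a = 1) ∧ γ = ∑ x, μ x • ∑ a, c x a • ν x a ∧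
      ∀ x a, 0 < c x a → ∃ T : LabelledTree (PathLabel X), IsPathTree P T ∧ (T.label []).1 = x ∧
        HasSum (fun σ : T.leaves => (T.label σ).2.1 • dirac (T.label σ).1) (ν x a) := by
  classical
  obtain ⟨p, hp, -⟩ := h.exists_policy hP
  let D : X → Option P → ℕ → X → ℝ≥0 := fun x a n => ∑ σ ∈ (p.tree (x, a)).leavesBelow n,
    ((p.tree (x, a)).label σ).2.1 • dirac ((p.tree (x, a)).label σ).1
  have hpath (x : X) (a : Option P) (hc : 0 < p.choose x a) : IsPathTree P (p.tree (x, a)) := by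
    refine p.isPathTree_tree hP _ fun t ht => ?_
    obtain rfl : a = some t := ht
    by_contra hne
    exact hc.ne' (if_neg hne)
  have hsum (x : X) (a : Option P) (hc : 0 < p.choose x a) :=
    ((hpath x a hc).isUnfolding.summable hP).hasSum
  refine ⟨p.choose, fun x a => ∑' σ : (p.tree (x, a)).leaves,
    ((p.tree (x, a)).label σ).2.1 • dirac ((p.tree (x, a)).label σ).1, p.sum_choose, ?_,
    fun x a hc => ⟨_, hpath x a hc, ?_, hsum x a hc⟩⟩
  · have hlim : Tendsto (fun n => ∑ x, μ x • ∑ a, p.choose x a • D x a n) atTop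
        (𝓝 (∑ x, μ x • ∑ a, p.choose x a • ∑' σ : (p.tree (x, a)).leaves,
          ((p.tree (x, a)).label σ).2.1 • dirac ((p.tree (x, a)).label σ).1)) := by
      refine tendsto_finsetSum _ fun x _ => (tendsto_finsetSum _ fun a _ => ?_).const_smul _
      rcases eq_or_ne (p.choose x a) 0 with hc | hc
      · simp [hc]
      · exact ((hsum x a (pos_iff_ne_zero.mpr hc)).comp
          (LabelledTree.tendsto_leavesBelow _)).const_smul _
    refine tendsto_nhds_unique hp (hlim.congr fun n => ?_)
    rw [← p.sum_decided_leavesBelow hP, Fintype.sum_prod_type]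
    refine Finset.sum_congr rfl fun x _ => ?_
    rw [Finset.smul_sum]
    exact Finset.sum_congr rfl fun a _ => by rw [smul_smul]; rfl
  · rw [Policy.tree, label_unfoldTree _ _ _ (n := ((x, a), 1)) (by simp [walk])]; rfl


end PolicyTree

/-! ### Combined and lifted transitions -/

section Combined

variable {S : Type*} [Fintype S] [DecidableEq S]

theorem sum_eq_sum_equivFin {A B : Type*} [Fintype A] [AddCommMonoid B] (F : Finset A)
    (f : A → B) (h : ∀ a ∉ F, f a = 0) : ∑ a, f a = ∑ i, f (F.equivFin.symm i) := by
  rw [F.equivFin.symm.sum_comp (fun a : F => f a), Finset.sum_coe_sort F f]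
  exact (Finset.sum_subset (Finset.subset_univ F) fun a _ ha => h a ha).symm

theorem Combined.of_fintype {Q : S → (S → ℝ≥0) → Prop} {s : S} {A : Type*} [Fintype A]
    {c : A → ℝ≥0} {ν : A → S → ℝ≥0} (hc : ∑ a, c a = 1) (hQ : ∀ a, 0 < c a → Q s (ν a)) :
    Combined Q s (∑ a, c a • ν a) := by
  classical
  let F := Finset.univ.filter fun a => 0 < c a
  have h0 (a : A) (ha : a ∉ F) : c a = 0 := by simpa [F] using ha
  have hpos (i) : 0 < c (F.equivFin.symm i) := (Finset.mem_filter.mp (F.equivFin.symm i).2).2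
  exact ⟨_, fun i => c (F.equivFin.symm i), fun i => ν (F.equivFin.symm i), hpos,
    by rw [← sum_eq_sum_equivFin F c h0, hc], fun i => hQ _ (hpos i),
    sum_eq_sum_equivFin F (fun a => c a • ν a) fun a ha => by simp [h0 a ha]⟩

theorem sum_push_smul {X Y : Type*} [Fintype X] [Fintype Y] [DecidableEq Y]
    {V : Type*} [AddCommMonoid V] [Module ℝ≥0 V] (φ : X → Y) (μ : X → ℝ≥0) (F : Y → V) :
    ∑ y, push φ μ y • F y = ∑ x, μ x • F (φ x) := by
  classical
  simp only [push_apply, Finset.sum_apply, Finset.sum_smul, Pi.smul_apply, smul_eq_mul]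
  rw [Finset.sum_comm]
  refine Finset.sum_congr rfl fun x _ => ?_
  simp [dirac_apply]

end Combined

/-! ### Weak transitions as flows -/

/-- Layers `0`, `1`, `2`: the number of visible actions so far, where `2` means two or more. -/
def cap (n : ℕ) : Fin 3 := ⟨min n 2, by omega⟩

theorem cap_cap_add (m n : ℕ) : cap (cap m + n) = cap (m + n) := by
  simp only [cap, Fin.mk.injEq]; omega

namespace LabelledTree

theorem take_mem_inner {L : Type*} (T : LabelledTree L) {σ : List ℕ} (hσ : σ ∈ T.nodes) {i : ℕ}
    (hi : i < σ.length) : σ.take i ∈ T.inner := by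
  refine ⟨T.prefix_mem _ _ hσ (List.take_prefix i σ), fun h =>
    h.2 ⟨σ, hσ, List.take_prefix i σ, ?_⟩⟩
  intro h
  have := congrArg List.length h
  simp at this
  omega

theorem mem_inner_of_append {L : Type*} (T : LabelledTree L) {σ : List ℕ} {i : ℕ}
    (h : σ ++ [i] ∈ T.nodes) : σ ∈ T.inner := by
  simpa using T.take_mem_inner h (i := σ.length) (by simp)

end LabelledTree

namespace MarkovAutomaton

variable {S Act : Type*} [Fintype S] [DecidableEq S]

theorem size_succDist (M : MarkovAutomaton S Act) (s : S) : size (M.succDist s) = 1 := by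
  classical
  unfold succDist
  split_ifs with h
  · simp only [size, ← Finset.sum_div]
    exact div_self h
  · exact size_dirac s

theorem Step.size_eq {M : MarkovAutomaton S Act} {s : S} {α : M.ActChi} {μ : S → ℝ≥0}
    (h : M.Step s α μ) : size μ = 1 := by
  cases α with
  | inl a => exact M.pt_dist _ h
  | inr r => rw [h.2.2]; exact M.size_succDist s

theorem finite_steps (M : MarkovAutomaton S Act) (α : M.ActChi) :
    {t : S × (S → ℝ≥0) | M.Step t.1 α t.2}.Finite := by
  cases α with
  | inl a =>
    refine Set.Finite.preimage (f := fun t : S × (S → ℝ≥0) => (t.1, a, t.2)) ?_ M.pt.finite_toSet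
    rintro ⟨s, μ⟩ _ ⟨s', μ'⟩ _ h
    simp only [Prod.mk.injEq, true_and] at h
    exact Prod.ext h.1 h.2
  | inr r =>
    refine (Set.finite_range fun s => (s, M.succDist s)).subset ?_
    rintro ⟨s, μ⟩ ⟨-, -, h⟩
    exact ⟨s, by simp_all⟩

open Classical in
/-- The visible actions count `1`, the internal action counts `0`. -/
noncomputable def weight (M : MarkovAutomaton S Act) (α : M.ActChi) : ℕ :=
  if α = M.tauChi then 0 else 1

@[simp] theorem weight_tau (M : MarkovAutomaton S Act) : M.weight M.tauChi = 0 := by simp [weight]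

theorem weight_of_ne (M : MarkovAutomaton S Act) {α : M.ActChi} (h : α ≠ M.tauChi) :
    M.weight α = 1 := by simp [weight, h]

theorem weight_le_one (M : MarkovAutomaton S Act) (α : M.ActChi) : M.weight α ≤ 1 := by
  unfold weight; split_ifs <;> simp

/-- `u` is a transition of `PA(M)` labelled `β` between states that carry a layer: its target lies
in the single layer obtained from that of the source by counting `β`. The underlying transition is
recovered by forgetting the layers. -/
def IsLayered (M : MarkovAutomaton S Act) (β : M.ActChi)
    (u : (S × Fin 3) × (S × Fin 3 → ℝ≥0)) : Prop :=
  M.Step u.1.1 β (push Prod.fst u.2) ∧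
    u.2 = push (fun s => (s, cap (u.1.2 + M.weight β))) (push Prod.fst u.2)

theorem isLayered_mk {M : MarkovAutomaton S Act} {s : S} {β : M.ActChi} {ν : S → ℝ≥0}
    (h : M.Step s β ν) (k : Fin 3) :
    M.IsLayered β ((s, k), push (fun s => (s, cap (k + M.weight β))) ν) := by
  have : push Prod.fst (push (fun s => (s, cap (k + M.weight β))) ν) = ν :=
    (push_push _ _ _).trans (push_id ν)
  exact ⟨by rw [this]; exact h, by rw [this]⟩

theorem finite_layered (M : MarkovAutomaton S Act) (β : M.ActChi) :
    {u | M.IsLayered β u}.Finite := by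
  refine (((M.finite_steps β).prod (Set.finite_univ (α := Fin 3))).image fun t =>
    ((t.1.1, t.2), push (fun s => (s, cap (t.2 + M.weight β))) t.1.2)).subset ?_
  rintro ⟨⟨s, k⟩, ν⟩ ⟨h1, h2⟩
  exact ⟨((s, push Prod.fst ν), k), ⟨h1, trivial⟩, Prod.ext rfl h2.symm⟩

open Classical in
/-- The transitions of `PA(M)` labelled `τ` or `α`, on states that count visible actions. -/
noncomputable def layered (M : MarkovAutomaton S Act) (α : M.ActChi) :
    Finset ((S × Fin 3) × (S × Fin 3 → ℝ≥0)) :=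
  (M.finite_layered M.tauChi).toFinset ∪ (M.finite_layered α).toFinset

theorem mem_layered {M : MarkovAutomaton S Act} {α : M.ActChi}
    {u : (S × Fin 3) × (S × Fin 3 → ℝ≥0)} :
    u ∈ M.layered α ↔ ∃ β, (β = α ∨ β = M.tauChi) ∧ M.IsLayered β u := by
  simp only [layered, Finset.mem_union, Set.Finite.mem_toFinset, Set.mem_ofPred_eq]
  constructor
  · rintro (h | h)
    exacts [⟨_, .inr rfl, h⟩, ⟨_, .inl rfl, h⟩]
  · rintro ⟨β, rfl | rfl, h⟩
    exacts [.inr h, .inl h]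

theorem size_of_mem_layered {M : MarkovAutomaton S Act} {α : M.ActChi} :
    ∀ u ∈ M.layered α, size u.2 = 1 := by
  intro u hu
  obtain ⟨β, -, h, -⟩ := mem_layered.mp hu
  simpa using h.size_eq

/-- The combined weak transition with label `α̂` between mass functions of equal size, as a flow
from layer `0` to layer `1`, or within layer `0` if `α = τ`. Masses that pass a second visible action
are in layer `2` for good, so they cannot contribute. -/
def WeakFlow (M : MarkovAutomaton S Act) (α : M.ActChi) (μ γ : S → ℝ≥0) : Prop :=
  MassFlow (M.layered α) (push (fun s => (s, cap 0)) μ) (push (fun s => (s, cap (M.weight α))) γ)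

/-- The number of visible actions strictly above the node `σ`. -/
noncomputable def Tree.height {M : MarkovAutomaton S Act} (T : M.Tree) (σ : List ℕ) : ℕ :=
  ∑ i ∈ Finset.range σ.length, (T.act (σ.take i)).elim 0 M.weight

theorem Tree.height_append {M : MarkovAutomaton S Act} (T : M.Tree) (σ : List ℕ) (i : ℕ) :
    T.height (σ ++ [i]) = T.height σ + (T.act σ).elim 0 M.weight := by
  rw [height, List.length_append, List.length_singleton, Finset.sum_range_succ]
  congr 1
  · refine Finset.sum_congr rfl fun j hj => ?_
    rw [List.take_append_of_le_length (Finset.mem_range.mp hj).le]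
  · simp

/-- Both kinds of weak transitions are given by the same condition on the visible actions above
the leaves. -/
theorem weakHat_iff {M : MarkovAutomaton S Act} {α : M.ActChi} {s : S} {ν : S → ℝ≥0} :
    M.WeakHat α s ν ↔ ∃ T : M.Tree, M.IsTransitionTree T ∧ T.sta [] = s ∧ M.Induces T ν ∧
      (∀ σ ∈ T.inner, T.act σ = some α ∨ T.act σ = some M.tauChi) ∧
      ∀ σ ∈ T.leaves, T.height σ = M.weight α := by
  classical
  by_cases hα : α = M.tauChi
  · subst hα
    simp only [WeakHat, Weak, ne_eq, not_true_eq_false, false_and, or_false, true_and, or_self,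
      weight_tau]
    refine exists_congr fun T => and_congr_right fun _ => and_congr_right fun _ =>
      and_congr_right fun _ => ⟨fun h => ⟨h, fun σ hσ => ?_⟩, fun h => h.1⟩
    refine Finset.sum_eq_zero fun i hi => ?_
    rw [h _ (T.take_mem_inner hσ.1 (Finset.mem_range.mp hi))]
    simp
  · simp only [WeakHat, WeakAct, hα, false_and, false_or, ne_eq, not_false_eq_true, true_and,
      forall_const, M.weight_of_ne hα]
    refine exists_congr fun T => and_congr_right fun hT => and_congr_right fun _ =>
      and_congr_right fun _ => ?_
    have hheight (hin : ∀ σ ∈ T.inner, T.act σ = some α ∨ T.act σ = some M.tauChi)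
        (σ : List ℕ) (hσ : σ ∈ T.leaves) : T.height σ =
          ((Finset.range σ.length).filter fun i => T.act (σ.take i) = some α).card := by
      rw [Finset.card_filter]
      refine Finset.sum_congr rfl fun i hi => ?_
      rcases hin _ (T.take_mem_inner hσ.1 (Finset.mem_range.mp hi)) with h | h
      · simp [h, M.weight_of_ne hα]
      · simp [h, Ne.symm hα]
    -- a leaf carries no action, so the prefix that carries `α` is a proper one
    have hlt {σ ρ : List ℕ} (hσ : σ ∈ T.leaves) (hρ : ρ <+: σ) (h : T.act ρ = some α) :
        ρ.length < σ.length ∧ σ.take ρ.length = ρ := by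
      refine ⟨lt_of_le_of_ne hρ.length_le fun hl => ?_, (List.prefix_iff_eq_take.mp hρ).symm⟩
      rw [hρ.eq_of_length hl, hT.act_leaf σ hσ] at h
      cases h
    constructor
    · rintro ⟨-, hex, hin⟩
      refine ⟨hin, fun σ hσ => ?_⟩
      rw [hheight hin σ hσ]
      obtain ⟨ρ, ⟨hρ, hρα⟩, huniq⟩ := hex σ hσ
      refine Finset.card_eq_one.mpr ⟨ρ.length, Finset.eq_singleton_iff_unique_mem.mpr ⟨?_, ?_⟩⟩
      · have := hlt hσ hρ hρα
        simp [this.1, this.2, hρα]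
      · intro i hi
        simp only [Finset.mem_filter, Finset.mem_range] at hi
        rw [← huniq _ ⟨List.take_prefix i σ, hi.2⟩]
        simp [hi.1.le]
    · rintro ⟨hin, hh⟩
      have hex : ∀ σ ∈ T.leaves, ∃! ρ, ρ <+: σ ∧ T.act ρ = some α := by
        intro σ hσ
        have h1 := hh σ hσ
        rw [hheight hin σ hσ, Finset.card_eq_one] at h1
        obtain ⟨i, hi⟩ := h1
        have hmem : i ∈ (Finset.range σ.length).filter fun i => T.act (σ.take i) = some α := by
          simp [hi]
        refine ⟨σ.take i, ⟨List.take_prefix i σ, (Finset.mem_filter.mp hmem).2⟩, ?_⟩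
        rintro ρ ⟨hρ, hρα⟩
        have := hlt hσ hρ hρα
        have hm : ρ.length ∈ (Finset.range σ.length).filter
            fun i => T.act (σ.take i) = some α := by
          simp [this.1, this.2, hρα]
        rw [hi, Finset.mem_singleton] at hm
        rw [← hm, this.2]
      exact ⟨fun σ hσ => (hex σ hσ).exists, hex, hin⟩

/-! #### From trees to flows -/

theorem Tree.isUnfolding {M : MarkovAutomaton S Act} {α : M.ActChi} {T : M.Tree}
    (hT : M.IsTransitionTree T)
    (hin : ∀ σ ∈ T.inner, T.act σ = some α ∨ T.act σ = some M.tauChi) :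
    IsUnfolding (M.layered α) T (fun σ => (T.sta σ, cap (T.height σ))) T.prob where
  root := hT.prob_root
  inner := by
    intro σ hσ
    obtain ⟨β, μ, hact, hstep, hsum⟩ := hT.step_inner σ hσ
    refine ⟨_, mem_layered.mpr ⟨β, ?_, isLayered_mk hstep (cap (T.height σ))⟩, rfl, ?_⟩
    · simpa [hact] using hin σ hσ
    · change T.prob σ • push _ μ = _
      rw [← map_smul, hsum, map_sum]
      refine Finset.sum_congr rfl fun i _ => ?_
      rw [map_smul, push_dirac, T.height_append, hact, cap_cap_add]
      rfl

theorem Tree.hasSum_layered {M : MarkovAutomaton S Act} {T : M.Tree} {ν : S → ℝ≥0} {k : ℕ}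
    (hind : M.Induces T ν) (hh : ∀ σ ∈ T.leaves, T.height σ = k) :
    HasSum (fun σ : T.leaves => T.prob σ • (dirac (T.sta σ, cap (T.height σ)) : S × Fin 3 → ℝ≥0))
      (push (fun s => (s, cap k)) ν) := by
  have := HasSum.map hind (push fun s => (s, cap k)) (continuous_push _)
  refine this.congr_fun fun σ => ?_
  simp [hh σ σ.2]

theorem WeakHat.size_le_one {M : MarkovAutomaton S Act} {α : M.ActChi} {s : S} {ν : S → ℝ≥0}
    (h : M.WeakHat α s ν) : size ν ≤ 1 := by
  obtain ⟨T, hT, rfl, hind, hin, hh⟩ := weakHat_iff.mp h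
  simpa using (Tree.isUnfolding hT hin).size_le_one size_of_mem_layered
    (Tree.hasSum_layered hind hh)

theorem WeakHat.weakFlow {M : MarkovAutomaton S Act} {α : M.ActChi} {s : S} {ν : S → ℝ≥0}
    (h : M.WeakHat α s ν) (hν : size ν = 1) : M.WeakFlow α (dirac s) ν := by
  obtain ⟨T, hT, rfl, hind, hin, hh⟩ := weakHat_iff.mp h
  have := (Tree.isUnfolding hT hin).massFlow size_of_mem_layered
    (Tree.hasSum_layered hind hh) (by simpa using hν)
  simpa [WeakFlow, Tree.height] using this

end MarkovAutomaton

namespace MarkovAutomaton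

variable {S Act : Type*} [Fintype S] [DecidableEq S]

/-! #### From flows to trees -/

open Classical in
/-- An action that labels the layered transition `u`. -/
noncomputable def actionOf (M : MarkovAutomaton S Act) (α : M.ActChi)
    (u : (S × Fin 3) × (S × Fin 3 → ℝ≥0)) : M.ActChi :=
  if h : ∃ β, (β = α ∨ β = M.tauChi) ∧ M.IsLayered β u then h.choose else α

theorem actionOf_spec {M : MarkovAutomaton S Act} {α : M.ActChi}
    {u : (S × Fin 3) × (S × Fin 3 → ℝ≥0)} (hu : u ∈ M.layered α) :
    (M.actionOf α u = α ∨ M.actionOf α u = M.tauChi) ∧ M.IsLayered (M.actionOf α u) u := by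
  have h := mem_layered.mp hu
  rw [actionOf, dif_pos h]
  exact h.choose_spec

/-- Forget the layers of a tree of layered transitions and keep only the actions. -/
noncomputable def treeOf (M : MarkovAutomaton S Act) (α : M.ActChi)
    (T : LabelledTree (PathLabel (S × Fin 3))) : M.Tree :=
  T.mapLabel fun l => (l.1.1, l.2.1, l.2.2.map (M.actionOf α))

theorem layer_eq_of_pos (ξ : S × Fin 3 → ℝ≥0) (x : S × Fin 3) (k : Fin 3)
    (h : ξ = push (fun s => (s, k)) (push Prod.fst ξ)) (hx : 0 < ξ x) : x.2 = k := by
  by_contra hne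
  rw [h, push_eval] at hx
  refine hx.ne' (Finset.sum_eq_zero fun s _ => if_neg ?_)
  rintro rfl
  exact hne rfl

section

variable {M : MarkovAutomaton S Act} {α : M.ActChi} {T : LabelledTree (PathLabel (S × Fin 3))}

theorem isTransitionTree_treeOf (hT : IsPathTree (M.layered α) T) :
    M.IsTransitionTree (M.treeOf α T) where
  prob_root := hT.root
  act_leaf σ hσ := by
    change (T.label σ).2.2.map _ = none
    rw [hT.leaf σ hσ]; rfl
  step_inner σ hσ := by
    obtain ⟨u, hu, hlab, hpos, hsum⟩ := hT.inner σ hσ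
    refine ⟨M.actionOf α u, push Prod.fst u.2, ?_, ?_, ?_⟩
    · change (T.label σ).2.2.map _ = _
      rw [hlab]; rfl
    · have := (actionOf_spec hu).2.1
      rw [hpos] at this
      exact this
    · change (T.label σ).2.1 • _ = _
      rw [← map_smul, hsum, map_sum]
      refine Finset.sum_congr rfl fun i _ => ?_
      rw [map_smul, push_dirac]
      rfl

theorem act_treeOf (hT : IsPathTree (M.layered α) T) :
    ∀ σ ∈ (M.treeOf α T).inner,
      (M.treeOf α T).act σ = some α ∨ (M.treeOf α T).act σ = some M.tauChi := by
  intro σ hσ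
  obtain ⟨u, hu, hlab, -⟩ := hT.inner σ hσ
  have : (M.treeOf α T).act σ = some (M.actionOf α u) := by
    change (T.label σ).2.2.map _ = _
    rw [hlab]; rfl
  simpa [this] using (actionOf_spec hu).1

/-- The layers count the visible actions: every child has positive probability, so its layer is the
one determined by the transition of its parent. -/
theorem layer_eq_height (hT : IsPathTree (M.layered α) T) (h0 : (T.label []).1.2 = cap 0)
    {σ : List ℕ} (hσ : σ ∈ T.nodes) :
    (T.label σ).1.2 = cap ((M.treeOf α T).height σ) := by
  induction σ using List.reverseRecOn with
  | nil => simpa [Tree.height] using h0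
  | append_singleton σ i ih =>
    have hin := T.mem_inner_of_append hσ
    obtain ⟨u, hu, hlab, hpos, hsum⟩ := hT.inner σ hin
    have hact : (M.treeOf α T).act σ = some (M.actionOf α u) := by
      change (T.label σ).2.2.map _ = _
      rw [hlab]; rfl
    have hu2 : 0 < u.2 (T.label (σ ++ [i])).1 := by
      have h1 := congrFun hsum (T.label (σ ++ [i])).1
      rw [Finset.sum_apply] at h1
      have h2 : 0 < ∑ j ∈ T.children σ,
          ((T.label (σ ++ [j])).2.1 • (dirac (T.label (σ ++ [j])).1 : S × Fin 3 → ℝ≥0))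
            (T.label (σ ++ [i])).1 :=
        (hT.pos _ hσ).trans_le <| le_of_eq_of_le (by simp)
          (Finset.single_le_sum (f := fun j =>
            ((T.label (σ ++ [j])).2.1 • (dirac (T.label (σ ++ [j])).1 : S × Fin 3 → ℝ≥0))
              (T.label (σ ++ [i])).1) (fun _ _ => zero_le) (T.mem_children.mpr hσ))
      rw [← h1, Pi.smul_apply, smul_eq_mul] at h2
      exact pos_of_mul_pos_right h2 zero_le
    rw [layer_eq_of_pos _ _ _ (actionOf_spec hu).2.2 hu2, hpos, ih hin.1, Tree.height_append, hact,
      cap_cap_add]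
    rfl

theorem induces_treeOf {ν : S × Fin 3 → ℝ≥0}
    (hν : HasSum (fun σ : T.leaves => (T.label σ).2.1 • dirac (T.label σ).1) ν) :
    M.Induces (M.treeOf α T) (push Prod.fst ν) := by
  have := HasSum.map hν (push Prod.fst) (continuous_push _)
  refine this.congr_fun fun σ => ?_
  simp only [Function.comp, map_smul, push_dirac]
  rfl

theorem IsPathTree.weakHat (hT : IsPathTree (M.layered α) T) {s : S}
    (hroot : (T.label []).1 = (s, cap 0)) {ν : S × Fin 3 → ℝ≥0}
    (hν : HasSum (fun σ : T.leaves => (T.label σ).2.1 • dirac (T.label σ).1) ν)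
    (hlayer : ∀ x, 0 < ν x → x.2 = cap (M.weight α)) : M.WeakHat α s (push Prod.fst ν) := by
  refine weakHat_iff.mpr ⟨M.treeOf α T, isTransitionTree_treeOf hT, ?_, induces_treeOf hν,
    act_treeOf hT, fun σ hσ => ?_⟩
  · change (T.label []).1.1 = s
    rw [hroot]
  · -- a leaf has positive probability, so its state is in the support of the outcome
    have hpos : 0 < ν (T.label σ).1 := by
      refine (hT.pos σ hσ.1).trans_le ?_
      have h1 := Pi.hasSum.mp hν (T.label σ).1
      have h2 := h1.summable.le_tsum ⟨σ, hσ⟩ fun _ _ => zero_le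
      rw [h1.tsum_eq] at h2
      simpa using h2
    have h := hlayer _ hpos
    rw [layer_eq_height hT (by rw [hroot]) hσ.1] at h
    have := M.weight_le_one α
    simp only [cap, Fin.mk.injEq] at h
    omega

/-- A weak flow from `μ` combines, for every state in the support of `μ`, finitely many trees. -/
theorem WeakFlow.lifted {μ γ : S → ℝ≥0} (h : M.WeakFlow α μ γ) :
    Lifted (Combined (M.WeakHat α)) μ γ := by
  obtain ⟨c, ν, hc, hγ, hT⟩ := MassFlow.exists_trees size_of_mem_layered h
  rw [sum_push_smul] at hγ
  refine ⟨fun s => ∑ a, c (s, cap 0) a • push Prod.fst (ν (s, cap 0) a), fun s hs =>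
    Combined.of_fintype (hc _) fun a ha => ?_, ?_⟩
  · obtain ⟨T, hpath, hroot, hsum⟩ := hT _ a ha
    refine IsPathTree.weakHat hpath hroot hsum fun x hx => ?_
    refine layer_eq_of_pos (push (fun s => (s, cap (M.weight α))) γ) x _ ?_ ?_
    · conv_lhs => rw [← push_id γ,
        ← show Prod.fst ∘ (fun s : S => (s, cap (M.weight α))) = id from rfl, ← push_push]
    · rw [hγ, Finset.sum_apply]
      have h1 : 0 < (μ s • ∑ a, c (s, cap 0) a • ν (s, cap 0) a) x := by
        rw [Pi.smul_apply, Finset.sum_apply, smul_eq_mul]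
        refine mul_pos hs ((mul_pos ha hx).trans_le ?_)
        exact Finset.single_le_sum (f := fun a => (c (s, cap 0) a • ν (s, cap 0) a) x)
          (fun _ _ => zero_le) (Finset.mem_univ a)
      exact h1.trans_le (Finset.single_le_sum
        (f := fun s => (μ s • ∑ a, c (s, cap 0) a • ν (s, cap 0) a) x)
        (fun _ _ => zero_le) (Finset.mem_univ s))
  · have h1 := congrArg (push Prod.fst) hγ
    rw [push_push, show Prod.fst ∘ (fun s : S => (s, cap (M.weight α))) = id from rfl,
      push_id] at h1
    simpa [map_sum] using h1

end

/-! ### Calculus of weak flows -/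

section

variable {M : MarkovAutomaton S Act} {α β : M.ActChi} {μ γ η μ' γ' : S → ℝ≥0}

namespace WeakFlow

theorem size_eq (h : M.WeakFlow α μ γ) : size μ = size γ := by
  simpa using MassFlow.size_eq size_of_mem_layered h

theorem refl (μ : S → ℝ≥0) : M.WeakFlow M.tauChi μ μ := by
  simpa [WeakFlow] using MassFlow.refl _

theorem add (h : M.WeakFlow α μ γ) (h' : M.WeakFlow α μ' γ') :
    M.WeakFlow α (μ + μ') (γ + γ') := by
  simpa [WeakFlow] using MassFlow.add h h'

theorem smul (c : ℝ≥0) (h : M.WeakFlow α μ γ) : M.WeakFlow α (c • μ) (c • γ) := by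
  simpa [WeakFlow] using MassFlow.smul c h

theorem sum {ι : Type*} (s : Finset ι) {f g : ι → S → ℝ≥0}
    (h : ∀ i ∈ s, M.WeakFlow α (f i) (g i)) : M.WeakFlow α (∑ i ∈ s, f i) (∑ i ∈ s, g i) := by
  simpa [WeakFlow] using MassFlow.sum s h

theorem zero : M.WeakFlow α 0 0 := by simpa using sum (M := M) (α := α) (ι := ℕ) ∅ (f := 0) (g := 0)

theorem isClosed (M : MarkovAutomaton S Act) (α : M.ActChi) :
    IsClosed {p : (S → ℝ≥0) × (S → ℝ≥0) | M.WeakFlow α p.1 p.2} :=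
  (MassFlow.isClosed (M.layered α)).preimage
    (((continuous_push _).comp continuous_fst).prodMk ((continuous_push _).comp continuous_snd))

/-- A weak flow with label `τ` or `α`, started in any layer. -/
theorem shift (hβ : β = α ∨ β = M.tauChi) (k : ℕ) (h : M.WeakFlow β μ γ) :
    MassFlow (M.layered α) (push (fun s => (s, cap k)) μ)
      (push (fun s => (s, cap (k + M.weight β))) γ) := by
  have := MassFlow.map (Q := M.layered α) (fun x : S × Fin 3 => (x.1, cap (k + x.2))) ?_ h
  · simp only [push_push, Function.comp_def] at this
    convert this using 3 <;> ext s <;> simp [cap]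
    have := M.weight_le_one β
    omega
  · rintro u hu
    obtain ⟨δ, hδ, hstep, hu2⟩ := mem_layered.mp hu
    refine mem_layered.mpr ⟨δ, ?_, ?_⟩
    · rcases hδ with rfl | rfl
      · exact hβ
      · exact .inr rfl
    · have := isLayered_mk hstep (cap (k + u.1.2))
      rw [hu2, push_push]
      simp only [Function.comp_def]
      convert this using 4
      ext s
      · rfl
      · simp [cap]; omega

theorem tau_trans (h : M.WeakFlow M.tauChi μ γ) (h' : M.WeakFlow α γ η) : M.WeakFlow α μ η := by
  have := h.shift (α := α) (.inr rfl) 0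
  simp only [weight_tau, add_zero] at this
  exact this.trans h'

theorem of_step {s : S} (h : M.Step s α μ) : M.WeakFlow α (dirac s) μ := by
  have := MassFlow.step (mem_layered.mpr ⟨α, .inl rfl, isLayered_mk h (cap 0)⟩)
  simpa [WeakFlow, cap] using this

end WeakFlow

theorem eq_one_of_sum_mul_eq {ι : Type*} [Fintype ι] {w a : ι → ℝ≥0} (ha : ∀ i, 0 < w i → a i ≤ 1)
    (h : ∑ i, w i * a i = ∑ i, w i) {i : ι} (hi : 0 < w i) : a i = 1 := by
  have hle (i : ι) : w i * a i ≤ w i := by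
    rcases eq_or_ne (w i) 0 with h0 | h0
    · simp [h0]
    · exact mul_le_of_le_one_right zero_le (ha i (pos_iff_ne_zero.mpr h0))
  have := (Finset.sum_eq_sum_iff_of_le fun i _ => hle i).mp h i (Finset.mem_univ i)
  exact mul_left_cancel₀ hi.ne' (by rw [this, mul_one])

/-- If a combined transition loses no mass, then neither does any of its parts. -/
theorem exists_parts_of_combined {s : S} (h : Combined (M.WeakHat α) s μ) (hμ : size μ = 1) :
    ∃ (n : ℕ) (c : Fin n → ℝ≥0) (ν : Fin n → S → ℝ≥0), (∀ i, 0 < c i) ∧ ∑ i, c i = 1 ∧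
      (∀ i, M.WeakHat α s (ν i) ∧ M.WeakFlow α (dirac s) (ν i)) ∧ μ = ∑ i, c i • ν i := by
  obtain ⟨n, c, ν, hc, hc1, hν, rfl⟩ := h
  refine ⟨n, c, ν, hc, hc1, fun i => ⟨hν i, (hν i).weakFlow ?_⟩, rfl⟩
  refine eq_one_of_sum_mul_eq (fun i _ => (hν i).size_le_one) ?_ (hc i)
  rw [hc1, ← hμ, size_sum]
  simp [size_smul]

theorem size_le_one_of_combined {s : S} (h : Combined (M.WeakHat α) s μ) : size μ ≤ 1 := by
  obtain ⟨n, c, ν, hc, hc1, hν, rfl⟩ := h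
  rw [size_sum, ← hc1]
  refine Finset.sum_le_sum fun i _ => ?_
  rw [size_smul]
  exact mul_le_of_le_one_right zero_le (hν i).size_le_one

namespace WeakFlow

theorem of_combined {s : S} (h : Combined (M.WeakHat α) s μ) (hμ : size μ = 1) :
    M.WeakFlow α (dirac s) μ := by
  obtain ⟨n, c, ν, -, hc1, hν, rfl⟩ := exists_parts_of_combined h hμ
  have := sum Finset.univ fun i _ => (hν i).2.smul (c i)
  rwa [← Finset.sum_smul, hc1, one_smul] at this

theorem exists_of_lifted (h : Lifted (Combined (M.WeakHat α)) μ γ) (hs : size μ = size γ) :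
    ∃ ν : S → S → ℝ≥0, (∀ s, 0 < μ s → Combined (M.WeakHat α) s (ν s) ∧
      M.WeakFlow α (dirac s) (ν s)) ∧ γ = ∑ s, μ s • ν s := by
  obtain ⟨ν, hν, rfl⟩ := h
  refine ⟨ν, fun s hμs => ⟨hν s hμs, of_combined (hν s hμs) ?_⟩, rfl⟩
  refine eq_one_of_sum_mul_eq (fun i hi => size_le_one_of_combined (hν i hi)) ?_ hμs
  change _ = size μ
  rw [hs, size_sum]
  simp [size_smul]

/-- A weak flow is the sum of weak flows from the states of its source. -/
theorem exists_pointwise (h : M.WeakFlow α μ γ) :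
    ∃ ν : S → S → ℝ≥0, (∀ s, 0 < μ s → M.WeakFlow α (dirac s) (ν s)) ∧
      γ = ∑ s, μ s • ν s := by
  obtain ⟨ν, hν, hγ⟩ := exists_of_lifted h.lifted h.size_eq
  exact ⟨ν, fun s hs => (hν s hs).2, hγ⟩

theorem bind {ν : S → S → ℝ≥0} (h : ∀ s, 0 < μ s → M.WeakFlow α (dirac s) (ν s)) :
    M.WeakFlow α μ (∑ s, μ s • ν s) := by
  conv_lhs => rw [← sum_smul_dirac μ]
  refine sum _ fun s _ => ?_
  rcases eq_or_ne (μ s) 0 with h0 | h0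
  · simpa [h0] using zero
  · exact (h s (pos_iff_ne_zero.mpr h0)).smul _

theorem of_lifted (h : Lifted (Combined (M.WeakHat α)) μ γ) (hs : size μ = size γ) :
    M.WeakFlow α μ γ := by
  obtain ⟨ν, hν, rfl⟩ := exists_of_lifted h hs
  exact bind fun s hs => (hν s hs).2

end WeakFlow

theorem weakHat_tau (M : MarkovAutomaton S Act) : M.WeakHat M.tauChi = M.Weak := by
  funext s μ
  simp [WeakHat]

theorem lifted_weak_iff : Lifted (Combined M.Weak) μ γ ∧ size μ = size γ ↔
    M.WeakFlow M.tauChi μ γ := by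
  rw [← M.weakHat_tau]
  exact ⟨fun h => .of_lifted h.1 h.2, fun h => ⟨h.lifted, h.size_eq⟩⟩

end

end MarkovAutomaton

/-- Projections along a compact set preserve closedness. -/
theorem IsClosed.exists_mem_isCompact {A B : Type*} [TopologicalSpace A] [TopologicalSpace B]
    {K : Set B} (hK : IsCompact K) {G : Set (A × B)} (hG : IsClosed G) :
    IsClosed {a | ∃ b ∈ K, (a, b) ∈ G} := by
  have := isCompact_iff_compactSpace.mp hK
  have h := isClosedMap_fst_of_compactSpace (X := A) (Y := K) _
    (hG.preimage (f := fun p : A × K => (p.1, (p.2 : B))) (by fun_prop))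
  convert h using 1
  ext a
  simp

section

variable {S : Type*} [Fintype S] [DecidableEq S]

theorem removeState_smul (c : ℝ≥0) (μ : S → ℝ≥0) (s : S) :
    removeState (c • μ) s = c • removeState μ s := by
  ext t; by_cases h : t = s <;> simp [removeState, h]

theorem removeState_add_distrib (μ ν : S → ℝ≥0) (s : S) :
    removeState (μ + ν) s = removeState μ s + removeState ν s := by
  ext t; by_cases h : t = s <;> simp [removeState, h]

theorem removeState_smul_dirac (c : ℝ≥0) (s : S) : removeState (c • dirac s) s = 0 := by
  ext t; by_cases h : t = s <;> simp [removeState, h, dirac_apply]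

theorem removeState_of_eq_zero {μ : S → ℝ≥0} {s : S} (h : μ s = 0) : removeState μ s = μ := by
  rw [removeState, ← h, Function.update_eq_self]

theorem continuous_removeState (s : S) : Continuous fun μ : S → ℝ≥0 => removeState μ s :=
  continuous_id.update s continuous_const

theorem size_removeState_add (μ : S → ℝ≥0) (s : S) :
    size (removeState μ s) + μ s = size μ := by
  conv_rhs => rw [← removeState_add μ s]
  simp [size_add, size_smul]

end

namespace MarkovAutomaton

variable {S Act : Type*} [Fintype S] [DecidableEq S]

/-! ### Weak bisimilarity in terms of flows -/

/-- `y` answers every state and transition of `x` by weak flows, up to `R`. -/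
def FlowAnswers (M : MarkovAutomaton S Act) (R : (S → ℝ≥0) → (S → ℝ≥0) → Prop)
    (x y : S → ℝ≥0) : Prop :=
  ∀ s, 0 < x s → ∀ α : M.ActChi, ∃ yg yb : S → ℝ≥0, M.WeakFlow M.tauChi y (yg + yb) ∧
    R (x s • dirac s) yg ∧ R (removeState x s) yb ∧
    ∀ ν, M.Step s α ν → ∃ y', M.WeakFlow α yg y' ∧ R (x s • ν) y'

theorem FlowAnswers.mono {M : MarkovAutomaton S Act} {R R' : (S → ℝ≥0) → (S → ℝ≥0) → Prop}
    (hR : ∀ x y, R x y → R' x y) {x y : S → ℝ≥0} (h : M.FlowAnswers R x y) :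
    M.FlowAnswers R' x y := by
  intro s hs α
  obtain ⟨yg, yb, hy, hg, hb, hstep⟩ := h s hs α
  refine ⟨yg, yb, hy, hR _ _ hg, hR _ _ hb, fun ν hν => ?_⟩
  obtain ⟨y', h1, h2⟩ := hstep ν hν
  exact ⟨y', h1, hR _ _ h2⟩

/-- Weak bisimilarity of mass functions of any size: the largest symmetric relation that preserves
sizes and is answered by weak flows. -/
def FlowBisim (M : MarkovAutomaton S Act) (x y : S → ℝ≥0) : Prop :=
  ∃ R : (S → ℝ≥0) → (S → ℝ≥0) → Prop, (∀ x y, R x y → R y x) ∧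
    (∀ x y, R x y → size x = size y ∧ M.FlowAnswers R x y) ∧ R x y

variable {M : MarkovAutomaton S Act} {α : M.ActChi} {x y z x' y' z' : S → ℝ≥0}

namespace FlowBisim

theorem symm (h : M.FlowBisim x y) : M.FlowBisim y x := by
  obtain ⟨R, hs, hR, h⟩ := h
  exact ⟨R, hs, hR, hs _ _ h⟩

theorem size_eq (h : M.FlowBisim x y) : size x = size y := by
  obtain ⟨R, -, hR, h⟩ := h
  exact (hR _ _ h).1

theorem answers (h : M.FlowBisim x y) : M.FlowAnswers M.FlowBisim x y := by
  obtain ⟨R, hs, hR, h⟩ := h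
  exact (hR _ _ h).2.mono fun a b hab => ⟨R, hs, hR, hab⟩

/-- Coinduction up to bisimilarity. -/
theorem coinduct {R : (S → ℝ≥0) → (S → ℝ≥0) → Prop} (hs : ∀ x y, R x y → R y x)
    (hR : ∀ x y, R x y → size x = size y ∧ M.FlowAnswers (fun a b => R a b ∨ M.FlowBisim a b) x y)
    (h : R x y) : M.FlowBisim x y := by
  refine ⟨fun a b => R a b ∨ M.FlowBisim a b, ?_, ?_, .inl h⟩
  · rintro a b (h | h)
    exacts [.inl (hs _ _ h), .inr h.symm]
  · rintro a b (h | h)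
    · exact hR _ _ h
    · exact ⟨h.size_eq, h.answers.mono fun _ _ => .inr⟩

theorem of_relation {R : (S → ℝ≥0) → (S → ℝ≥0) → Prop} (hs : ∀ x y, R x y → R y x)
    (hR : ∀ x y, R x y → size x = size y ∧ M.FlowAnswers R x y)
    (h : R x y) : M.FlowBisim x y := ⟨R, hs, hR, h⟩

theorem refl (x : S → ℝ≥0) : M.FlowBisim x x := by
  refine of_relation (R := Eq) (fun _ _ h => h.symm) ?_ rfl
  rintro x _ rfl
  refine ⟨rfl, fun s _ α => ⟨x s • dirac s, removeState x s, ?_, rfl, rfl, fun ν hν =>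
    ⟨x s • ν, (WeakFlow.of_step hν).smul _, rfl⟩⟩⟩
  rw [add_comm, removeState_add]
  exact WeakFlow.refl x

theorem smul (c : ℝ≥0) (h : M.FlowBisim x y) : M.FlowBisim (c • x) (c • y) := by
  refine of_relation (R := fun a b => ∃ c : ℝ≥0, ∃ x y, M.FlowBisim x y ∧ a = c • x ∧ b = c • y)
    ?_ ?_ ⟨c, x, y, h, rfl, rfl⟩
  · rintro _ _ ⟨c, x, y, h, rfl, rfl⟩
    exact ⟨c, y, x, h.symm, rfl, rfl⟩
  · rintro _ _ ⟨c, x, y, h, rfl, rfl⟩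
    refine ⟨by rw [size_smul, size_smul, h.size_eq], fun s hs α => ?_⟩
    rw [Pi.smul_apply, smul_eq_mul] at hs ⊢
    obtain ⟨yg, yb, hy, hg, hb, hstep⟩ := h.answers s (pos_of_mul_pos_right hs zero_le) α
    refine ⟨c • yg, c • yb, by simpa using hy.smul c, ⟨c, _, _, hg, mul_smul _ _ _, rfl⟩,
      ⟨c, _, _, hb, removeState_smul _ _ _, rfl⟩, fun ν hν => ?_⟩
    obtain ⟨y', h1, h2⟩ := hstep ν hν
    exact ⟨c • y', h1.smul c, c, _, _, h2, mul_smul _ _ _, rfl⟩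

/-- A state outside the support is answered by doing nothing, so positivity can be dropped. -/
theorem answers' (h : M.FlowBisim x y) (s : S) (α : M.ActChi) :
    ∃ yg yb : S → ℝ≥0, M.WeakFlow M.tauChi y (yg + yb) ∧
      M.FlowBisim (x s • dirac s) yg ∧ M.FlowBisim (removeState x s) yb ∧
      ∀ ν, M.Step s α ν → ∃ y', M.WeakFlow α yg y' ∧ M.FlowBisim (x s • ν) y' := by
  rcases eq_or_ne (x s) 0 with h0 | h0
  · refine ⟨0, y, by simpa using WeakFlow.refl y, by simpa [h0] using refl 0,
      by rwa [removeState_of_eq_zero h0], fun ν _ => ⟨0, WeakFlow.zero, by simpa [h0] using refl 0⟩⟩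
  · exact h.answers s (pos_iff_ne_zero.mpr h0) α

theorem add (h : M.FlowBisim x y) (h' : M.FlowBisim x' y') : M.FlowBisim (x + x') (y + y') := by
  refine of_relation (R := fun a b => ∃ x y x' y', M.FlowBisim x y ∧ M.FlowBisim x' y' ∧
    a = x + x' ∧ b = y + y') ?_ ?_ ⟨x, y, x', y', h, h', rfl, rfl⟩
  · rintro _ _ ⟨x, y, x', y', h, h', rfl, rfl⟩
    exact ⟨y, x, y', x', h.symm, h'.symm, rfl, rfl⟩
  · rintro _ _ ⟨x, y, x', y', h, h', rfl, rfl⟩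
    refine ⟨by rw [size_add, size_add, h.size_eq, h'.size_eq], fun s _ α => ?_⟩
    obtain ⟨yg, yb, hy, hg, hb, hstep⟩ := h.answers' s α
    obtain ⟨yg', yb', hy', hg', hb', hstep'⟩ := h'.answers' s α
    refine ⟨yg + yg', yb + yb', ?_, ⟨_, _, _, _, hg, hg', add_smul _ _ _, rfl⟩,
      ⟨_, _, _, _, hb, hb', removeState_add_distrib _ _ _, rfl⟩, fun ν hν => ?_⟩
    · rw [add_add_add_comm]
      exact hy.add hy'
    · obtain ⟨w, h1, h2⟩ := hstep ν hν
      obtain ⟨w', h1', h2'⟩ := hstep' ν hν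
      exact ⟨w + w', h1.add h1', _, _, _, _, h2, h2', add_smul _ _ _, rfl⟩

theorem sum {ι : Type*} (s : Finset ι) {f g : ι → S → ℝ≥0}
    (h : ∀ i ∈ s, M.FlowBisim (f i) (g i)) : M.FlowBisim (∑ i ∈ s, f i) (∑ i ∈ s, g i) := by
  classical
  induction s using Finset.induction_on with
  | empty => simpa using refl 0
  | insert a s ha ih =>
    rw [Finset.sum_insert ha, Finset.sum_insert ha]
    exact (h a (by simp)).add (ih fun i hi => h i (by simp [hi]))

theorem of_smul {c : ℝ≥0} (hc : c ≠ 0) (h : M.FlowBisim (c • x) (c • y)) : M.FlowBisim x y := by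
  simpa [smul_smul, hc] using h.smul c⁻¹

theorem eq_zero (h : M.FlowBisim 0 y) : y = 0 := by
  have := h.size_eq
  rw [size_zero] at this
  exact size_eq_zero.mp this.symm

/-- Weak bisimilarity is closed, since all answers range over compact sets. -/
theorem isClosed (M : MarkovAutomaton S Act) :
    IsClosed {p : (S → ℝ≥0) × (S → ℝ≥0) | M.FlowBisim p.1 p.2} := by
  set B := {p : (S → ℝ≥0) × (S → ℝ≥0) | M.FlowBisim p.1 p.2} with hB
  have hcl : IsClosed (closure B) := isClosed_closure
  refine isClosed_of_closure_subset fun p hp => ?_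
  refine of_relation (R := fun a b => (a, b) ∈ closure B) ?_ ?_ hp
  · intro a b hab
    exact map_mem_closure (f := Prod.swap) (t := B) continuous_swap hab fun p hp =>
      FlowBisim.symm hp
  · intro x y hxy
    have hsize : IsClosed {p : (S → ℝ≥0) × (S → ℝ≥0) | size p.1 = size p.2} :=
      isClosed_eq (continuous_size.comp continuous_fst) (continuous_size.comp continuous_snd)
    refine ⟨closure_minimal (fun p hp => FlowBisim.size_eq hp) hsize hxy, fun s hs α => ?_⟩
    let K := {μ : S → ℝ≥0 | size μ ≤ size y + 1}
    have hK : IsCompact K := isCompact_size_le _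
    let G : Set (((S → ℝ≥0) × (S → ℝ≥0)) × ((S → ℝ≥0) × (S → ℝ≥0))) :=
      {r | M.WeakFlow M.tauChi r.1.2 (r.2.1 + r.2.2) ∧
        (r.1.1 s • dirac s, r.2.1) ∈ closure B ∧ (removeState r.1.1 s, r.2.2) ∈ closure B ∧
        ∀ ν, M.Step s α ν → ∃ w ∈ K, M.WeakFlow α r.2.1 w ∧ (r.1.1 s • ν, w) ∈ closure B}
    have hrem := continuous_removeState s
    have hG : IsClosed G := by
      refine ((WeakFlow.isClosed M M.tauChi).preimage (f := fun r :
        ((S → ℝ≥0) × (S → ℝ≥0)) × ((S → ℝ≥0) × (S → ℝ≥0)) => (r.1.2, r.2.1 + r.2.2))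
          (by fun_prop)).inter ((hcl.preimage (by fun_prop)).inter ((hcl.preimage ?_).inter ?_))
      · exact (hrem.comp (by fun_prop)).prodMk (by fun_prop)
      · have : ∀ ν, IsClosed {r : ((S → ℝ≥0) × (S → ℝ≥0)) × ((S → ℝ≥0) × (S → ℝ≥0)) |
            M.Step s α ν → ∃ w ∈ K, M.WeakFlow α r.2.1 w ∧ (r.1.1 s • ν, w) ∈ closure B} := by
          intro ν
          by_cases hν : M.Step s α ν
          · simp only [hν, forall_const]
            exact IsClosed.exists_mem_isCompact hK (((WeakFlow.isClosed M α).preimage (f := fun q :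
              (((S → ℝ≥0) × (S → ℝ≥0)) × ((S → ℝ≥0) × (S → ℝ≥0))) × (S → ℝ≥0) => (q.1.2.1, q.2))
                (by fun_prop)).inter (hcl.preimage (f := fun q :
              (((S → ℝ≥0) × (S → ℝ≥0)) × ((S → ℝ≥0) × (S → ℝ≥0))) × (S → ℝ≥0) =>
                (q.1.1.1 s • ν, q.2)) (by fun_prop)))
          · simp [hν]
        have hinter := isClosed_iInter this
        rw [← Set.ofPred_forall] at hinter
        exact hinter
    have hA := IsClosed.exists_mem_isCompact (hK.prod hK) hG
    let U : Set ((S → ℝ≥0) × (S → ℝ≥0)) := {p | 0 < p.1 s ∧ size p.2 < size y + 1}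
    have hU : IsOpen U := by
      have h1 : Continuous fun p : (S → ℝ≥0) × (S → ℝ≥0) => size p.2 :=
        continuous_size.comp continuous_snd
      have hU1 : IsOpen {p : (S → ℝ≥0) × (S → ℝ≥0) | 0 < p.1 s} :=
        isOpen_lt continuous_const (by fun_prop)
      have hU2 : IsOpen {p : (S → ℝ≥0) × (S → ℝ≥0) | size p.2 < size y + 1} :=
        isOpen_lt h1 continuous_const
      exact hU1.inter hU2
    have hxyU : (x, y) ∈ closure (U ∩ B) :=
      hU.inter_closure ⟨⟨hs, lt_add_one _⟩, hxy⟩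
    obtain ⟨⟨yg, yb⟩, -, hy, hg, hb, hstep⟩ := closure_minimal (fun p hp => by
      obtain ⟨⟨hps, hpy⟩, hpB⟩ := hp
      obtain ⟨yg, yb, hy, hg, hb, hstep⟩ := FlowBisim.answers hpB s hps α
      have hsz := hy.size_eq
      rw [size_add] at hsz
      have hgK : size yg ≤ size y + 1 := le_trans (hsz ▸ le_self_add) hpy.le
      refine ⟨(yg, yb), ⟨hgK, le_trans (hsz ▸ le_add_self) hpy.le⟩, hy, subset_closure hg,
        subset_closure hb, fun ν hν => ?_⟩
      obtain ⟨w, h1, h2⟩ := hstep ν hν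
      exact ⟨w, (h1.size_eq ▸ hgK : size w ≤ _), h1, subset_closure h2⟩) hA hxyU
    refine ⟨yg, yb, hy, hg, hb, fun ν hν => ?_⟩
    obtain ⟨w, -, h1, h2⟩ := hstep ν hν
    exact ⟨w, h1, h2⟩

/-- What is bisimilar to `x` decomposes, after internal transitions, along the states of `x`. -/
theorem exists_pointwise (h : M.FlowBisim x y) : ∃ ys : S → S → ℝ≥0,
    M.WeakFlow M.tauChi y (∑ s, ys s) ∧ ∀ s, M.FlowBisim (x s • dirac s) (ys s) := by
  suffices H : ∀ (A : Finset S) (x y : S → ℝ≥0), (∀ s ∉ A, x s = 0) → M.FlowBisim x y →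
      ∃ ys : S → S → ℝ≥0, M.WeakFlow M.tauChi y (∑ s, ys s) ∧
        ∀ s, M.FlowBisim (x s • dirac s) (ys s) from H Finset.univ x y (by simp) h
  intro A
  induction A using Finset.induction_on with
  | empty =>
    intro x y hx h
    have hx0 : x = 0 := funext fun s => hx s (by simp)
    subst hx0
    rw [h.eq_zero]
    exact ⟨0, by simpa using WeakFlow.zero, fun s => by simpa using refl 0⟩
  | insert a A ha ih =>
    intro x y hx h
    obtain ⟨yg, yb, hy, hg, hb, -⟩ := h.answers' a M.tauChi
    obtain ⟨ys, hys, hs⟩ := ih (removeState x a) yb (fun s hsA => by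
      by_cases hsa : s = a
      · simp [removeState, hsa]
      · simpa [removeState, hsa] using hx s (by simp [hsa, hsA])) hb
    have ha0 : ys a = 0 := by
      have := hs a
      simp only [removeState, Function.update_self, zero_smul] at this
      exact this.eq_zero
    refine ⟨Function.update ys a yg, ?_, fun s => ?_⟩
    · have : ∑ s, Function.update ys a yg s = yg + ∑ s, ys s := by
        rw [Finset.sum_update_of_mem (Finset.mem_univ a), ← Finset.sum_erase_add _ _
          (Finset.mem_univ a), ha0, add_zero, Finset.sdiff_singleton_eq_erase]
      rw [this]
      exact hy.tau_trans ((WeakFlow.refl yg).add hys)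
    · by_cases hsa : s = a
      · subst hsa; simpa using hg
      · simpa [hsa, removeState] using hs s

/-- What is bisimilar to a sum decomposes, after internal transitions, into summands. -/
theorem split (h : M.FlowBisim (x + x') y) : ∃ z z', M.WeakFlow M.tauChi y (z + z') ∧
    M.FlowBisim x z ∧ M.FlowBisim x' z' := by
  obtain ⟨ys, hy, hs⟩ := h.exists_pointwise
  -- divide the part that belongs to `s` in the proportion `x s : x' s`
  have hpart (v : S → ℝ≥0) (hv : v ≤ x + x') :
      M.FlowBisim v (∑ s, (v s / (x + x') s) • ys s) := by
    conv => enter [2]; rw [← sum_smul_dirac v]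
    refine sum _ fun s _ => ?_
    have := (hs s).smul (v s / (x + x') s)
    rwa [smul_smul, div_mul_cancel_of_imp] at this
    intro h0
    exact le_antisymm (h0 ▸ hv s) zero_le
  refine ⟨_, _, ?_, hpart x le_self_add, hpart x' le_add_self⟩
  rw [← Finset.sum_add_distrib]
  convert hy using 2 with s
  rw [← add_smul, ← add_div]
  rcases eq_or_ne ((x + x') s) 0 with h0 | h0
  · have := hs s
    rw [h0, zero_smul] at this
    rw [this.eq_zero, smul_zero]
  · rw [← Pi.add_apply, div_self h0, one_smul]

end FlowBisim

end MarkovAutomaton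

namespace MarkovAutomaton

variable {S Act : Type*} [Fintype S] [DecidableEq S]

/-! ### Simulation of weak flows -/

/-- The mass in layer `k`. -/
def layer (k : Fin 3) : (S × Fin 3 → ℝ≥0) →ₗ[ℝ≥0] (S → ℝ≥0) :=
  LinearMap.funLeft ℝ≥0 ℝ≥0 fun s => (s, k)

theorem layer_push (j k : Fin 3) (μ : S → ℝ≥0) :
    layer j (push (fun s => (s, k)) μ) = if k = j then μ else 0 := by
  ext s
  rw [layer, LinearMap.funLeft_apply, push_eval]
  split_ifs with h
  · subst h; simp
  · simp [h]

theorem sum_push_layer (ξ : S × Fin 3 → ℝ≥0) :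
    ∑ k, push (fun s => (s, k)) (layer k ξ) = ξ := by
  ext ⟨s, j⟩
  simp only [Finset.sum_apply, push_eval, Prod.mk.injEq]
  rw [Finset.sum_eq_single j]
  · simp [layer, LinearMap.funLeft_apply]
  · intro k _ hk; simp [hk]
  · simp

theorem continuous_layer (k : Fin 3) :
    Continuous (layer k : (S × Fin 3 → ℝ≥0) → S → ℝ≥0) :=
  continuous_pi fun s => continuous_apply (s, k)

theorem cap_val (k : Fin 3) : cap (k : ℕ) = k := by
  ext; simp only [cap]; omega

variable {M : MarkovAutomaton S Act} {α : M.ActChi} {x y z x' y' z' : S → ℝ≥0}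

namespace FlowBisim

/-- Weak flows are simulated: the layered mass functions whose layers are bisimilar to the layers of
something reachable from `y` form a closed set, which is preserved by single transitions. -/
theorem simulate (h : M.FlowBisim x y) (hx : M.WeakFlow α x x') :
    ∃ y', M.WeakFlow α y y' ∧ M.FlowBisim x' y' := by
  let K := {ζ : S × Fin 3 → ℝ≥0 | size ζ ≤ size y}
  let A := {ξ : S × Fin 3 → ℝ≥0 | ∃ ζ ∈ K, (ξ, ζ) ∈
    {p : (S × Fin 3 → ℝ≥0) × (S × Fin 3 → ℝ≥0) |
      MassFlow (M.layered α) (push (fun s => (s, cap 0)) y) p.2 ∧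
        ∀ k, M.FlowBisim (layer k p.1) (layer k p.2)}}
  have hA : IsClosed A := by
    refine IsClosed.exists_mem_isCompact (isCompact_size_le _) (IsClosed.inter ?_ ?_)
    · exact (MassFlow.isClosed (M.layered α)).preimage (f := fun p :
        (S × Fin 3 → ℝ≥0) × (S × Fin 3 → ℝ≥0) => (push (fun s => (s, cap 0)) y, p.2))
        (by fun_prop)
    · have : ∀ k, IsClosed {p : (S × Fin 3 → ℝ≥0) × (S × Fin 3 → ℝ≥0) |
          M.FlowBisim (layer k p.1) (layer k p.2)} := fun k =>
        (FlowBisim.isClosed M).preimage (f := fun p :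
          (S × Fin 3 → ℝ≥0) × (S × Fin 3 → ℝ≥0) => (layer k p.1, layer k p.2))
          (((continuous_layer k).comp continuous_fst).prodMk
            ((continuous_layer k).comp continuous_snd))
      have hinter := isClosed_iInter this
      rw [← Set.ofPred_forall] at hinter
      exact hinter
  have hmem (ξ ζ : S × Fin 3 → ℝ≥0)
      (hf : MassFlow (M.layered α) (push (fun s => (s, cap 0)) y) ζ)
      (hb : ∀ k, M.FlowBisim (layer k ξ) (layer k ζ)) : ξ ∈ A := by
    refine ⟨ζ, ?_, hf, hb⟩
    have := hf.size_eq size_of_mem_layered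
    rw [size_push] at this
    exact this.ge
  have hfin := MassFlow.induction_closed size_of_mem_layered hA ?_
    (hmem (push (fun s => (s, cap 0)) x) _ (.refl _) fun k => ?_) hx
  · -- `x'` lies in one layer, and the empty layers are bisimilar only to empty ones
    obtain ⟨ζ, -, hf, hb⟩ := hfin
    have hζ : ζ = push (fun s => (s, cap (M.weight α))) (layer (cap (M.weight α)) ζ) := by
      conv_lhs => rw [← sum_push_layer ζ]
      refine Finset.sum_eq_single _ (fun k _ hk => ?_) (by simp)
      have := hb k
      rw [layer_push, if_neg hk.symm] at this
      rw [this.eq_zero, map_zero]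
    refine ⟨layer (cap (M.weight α)) ζ, ?_, ?_⟩
    · rw [WeakFlow, ← hζ]; exact hf
    · have := hb (cap (M.weight α))
      rwa [layer_push, if_pos rfl] at this
  · -- the mass `w` that moves splits off a part `b` of layer `k` of `ζ`, which answers the step
    rintro ⟨⟨s, k⟩, ν'⟩ hu ρ w ⟨ζ, -, hf, hb⟩
    obtain ⟨β, hβ, hstep, hν⟩ := mem_layered.mp hu
    set ν : S → ℝ≥0 := push Prod.fst ν'
    change ν' = push (fun s => (s, cap (k + M.weight β))) ν at hν
    have hdirac (j : Fin 3) : layer j (dirac (s, k)) = if k = j then dirac s else 0 := by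
      rw [← push_dirac (fun s => (s, k)), layer_push]
    have hk := hb k
    rw [map_add, map_smul, hdirac, if_pos rfl] at hk
    obtain ⟨a, b, hab, ha, hb'⟩ := hk.split
    obtain ⟨bg, bb, hbgb, hg, hbb, hans⟩ := hb'.answers' s β
    rw [removeState_smul_dirac] at hbb
    rw [hbb.eq_zero, add_zero] at hbgb
    obtain ⟨b', hb1, hb2⟩ := hans ν hstep
    simp only [Pi.smul_apply, dirac_self, smul_eq_mul, mul_one] at hb2
    set r : S × Fin 3 → ℝ≥0 := ∑ j ∈ Finset.univ.erase k, push (fun s => (s, j)) (layer j ζ) with hr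
    have hζ : ζ = r + push (fun s => (s, k)) (layer k ζ) := by
      conv_lhs => rw [← sum_push_layer ζ]
      exact (Finset.sum_erase_add _ _ (Finset.mem_univ k)).symm
    refine hmem _ (r + push (fun s => (s, k)) a + push (fun s => (s, cap (k + M.weight β))) b')
      (hf.trans ?_) fun j => ?_
    · conv => enter [2]; rw [hζ]
      rw [add_assoc]
      refine (MassFlow.refl r).add ?_
      have h1 := (hab.tau_trans ((WeakFlow.refl a).add hbgb)).shift (α := α) (.inr rfl) k
      have h2 := hb1.shift (α := α) hβ k
      rw [weight_tau, add_zero, cap_val, map_add] at h1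
      rw [cap_val] at h2
      exact h1.trans ((MassFlow.refl _).add h2)
    · change M.FlowBisim (layer j (ρ + w • ν')) _
      rw [map_add, map_smul, map_add, hν, layer_push, layer_push]
      refine FlowBisim.add ?_ ?_
      · have hj := hb j
        rw [map_add, map_smul, hdirac, hζ, map_add, layer_push] at hj
        rw [map_add, layer_push]
        split_ifs at hj ⊢ with hkj
        · subst hkj
          have : layer k r = 0 := by
            rw [hr, map_sum]
            exact Finset.sum_eq_zero fun j hj => by
              rw [layer_push, if_neg (Finset.ne_of_mem_erase hj)]
          rwa [this, zero_add]
        · simpa using hj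
      · split_ifs
        · exact hb2
        · simpa using refl 0
  · rw [layer_push, layer_push]
    split_ifs
    · exact h
    · exact refl 0

/-- Transitivity: the answers of `y` to `x` are weak flows, which `z` simulates. -/
theorem trans (h : M.FlowBisim x y) (h' : M.FlowBisim y z) : M.FlowBisim x z := by
  refine of_relation (R := fun a c => ∃ b, M.FlowBisim a b ∧ M.FlowBisim b c) ?_ ?_ ⟨y, h, h'⟩
  · rintro a c ⟨b, h, h'⟩
    exact ⟨b, h'.symm, h.symm⟩
  · rintro x z ⟨y, h, h'⟩
    refine ⟨h.size_eq.trans h'.size_eq, fun s hs α => ?_⟩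
    obtain ⟨yg, yb, hy, hg, hb, hstep⟩ := h.answers s hs α
    obtain ⟨z', hz, hyz⟩ := h'.simulate hy
    obtain ⟨zg, zb, hz', hgz, hbz⟩ := hyz.split
    refine ⟨zg, zb, hz.tau_trans hz', ⟨yg, hg, hgz⟩, ⟨yb, hb, hbz⟩, fun ν hν => ?_⟩
    obtain ⟨w, hw, hνw⟩ := hstep ν hν
    obtain ⟨w', hw', hww'⟩ := hgz.simulate hw
    exact ⟨w', hw', w, hνw, hww'⟩

/-- Two mass functions are bisimilar as soon as each of them evolves internally into something
bisimilar to the other. -/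
theorem of_weakFlow (h1 : M.WeakFlow M.tauChi x y') (h1' : M.FlowBisim y' y)
    (h2 : M.WeakFlow M.tauChi y x') (h2' : M.FlowBisim x' x) : M.FlowBisim x y := by
  refine coinduct (R := fun a b => (∃ b', M.WeakFlow M.tauChi a b' ∧ M.FlowBisim b' b) ∧
    ∃ a', M.WeakFlow M.tauChi b a' ∧ M.FlowBisim a' a) (fun a b h => ⟨h.2, h.1⟩) ?_
    ⟨⟨y', h1, h1'⟩, x', h2, h2'⟩
  rintro a b ⟨⟨b', hb, hb'⟩, a', ha, ha'⟩
  refine ⟨hb.size_eq.trans hb'.size_eq, fun s hs α => ?_⟩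
  obtain ⟨yg, yb, hy, hg, hbb, hstep⟩ := ha'.symm.answers s hs α
  exact ⟨yg, yb, ha.tau_trans hy, .inr hg, .inr hbb, fun ν hν =>
    let ⟨w, hw, hw'⟩ := hstep ν hν; ⟨w, hw, .inr hw'⟩⟩

open Filter Topology in
/-- Cancellation: `x` can be made arbitrarily small in proportion to `y` and `z`. -/
theorem cancel_left (h : M.FlowBisim (x + y) (x + z)) : M.FlowBisim y z := by
  have hn (n : ℕ) : M.FlowBisim (x + (n : ℝ≥0) • y) (x + (n : ℝ≥0) • z) := by
    induction n with
    | zero => simpa using refl x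
    | succ n ih =>
      have h1 := ih.add (refl y)
      have h2 := h.add (refl ((n : ℝ≥0) • z))
      push_cast
      rw [add_smul, add_smul, one_smul, one_smul]
      have e1 : x + (n : ℝ≥0) • z + y = x + y + (n : ℝ≥0) • z := by abel
      have e2 : x + z + (n : ℝ≥0) • z = x + ((n : ℝ≥0) • z + z) := by abel
      rw [e1] at h1
      rw [e2] at h2
      rw [← add_assoc]
      exact h1.trans h2
  have hlim (v : S → ℝ≥0) : Tendsto (fun n : ℕ => ((n + 1 : ℕ) : ℝ≥0)⁻¹ • x + v) atTop (𝓝 v) := by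
    have h0 : Tendsto (fun n : ℕ => ((n + 1 : ℕ) : ℝ≥0)⁻¹) atTop (𝓝 0) :=
      (tendsto_inv_atTop_nhds_zero_nat (𝕜 := ℝ≥0)).comp (tendsto_add_atTop_nat 1)
    have := (h0.smul_const x).add_const v
    simpa using this
  refine (FlowBisim.isClosed M).mem_of_tendsto ((hlim y).prodMk_nhds (hlim z))
    (Eventually.of_forall fun n => ?_)
  have := (hn (n + 1)).smul ((n + 1 : ℕ) : ℝ≥0)⁻¹
  have hne : ((n + 1 : ℕ) : ℝ≥0) ≠ 0 := by positivity
  rwa [smul_add, smul_add, smul_smul, smul_smul, inv_mul_cancel₀ hne, one_smul, one_smul] at this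

/-- If the sum does not change its class when both summands evolve, then neither does a summand. -/
theorem of_add (hx : M.WeakFlow M.tauChi x x') (hy : M.WeakFlow M.tauChi y y')
    (h : M.FlowBisim (x' + y') (x + y)) : M.FlowBisim x' x := by
  have h1 : M.FlowBisim (x' + y) (x + y) :=
    of_weakFlow ((WeakFlow.refl x').add hy) h (hx.add (WeakFlow.refl y)) (refl _)
  rw [add_comm x', add_comm x] at h1
  exact h1.cancel_left

theorem of_sum {ι : Type*} [Fintype ι] {f g : ι → S → ℝ≥0}
    (hf : ∀ i, M.WeakFlow M.tauChi (f i) (g i)) (h : M.FlowBisim (∑ i, g i) (∑ i, f i)) (i : ι) :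
    M.FlowBisim (g i) (f i) := by
  classical
  rw [← Finset.add_sum_erase _ _ (Finset.mem_univ i),
    ← Finset.add_sum_erase _ _ (Finset.mem_univ i)] at h
  exact of_add (hf i) (WeakFlow.sum _ fun j _ => hf j) h

end FlowBisim

end MarkovAutomaton

namespace MarkovAutomaton

variable {S Act : Type*} [Fintype S] [DecidableEq S]

/-! ### Mass on sets of states -/

/-- The mass on a set of states, as a linear map. -/
noncomputable def massLin (C : Set S) : (S → ℝ≥0) →ₗ[ℝ≥0] ℝ≥0 where
  toFun μ := massOn μ C
  map_add' μ ν := by simp [massOn, Set.indicator_add', Finset.sum_add_distrib]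
  map_smul' c μ := by
    classical
    simp [massOn, Finset.mul_sum, Set.indicator_apply]

theorem massOn_sum {ι : Type*} (s : Finset ι) (f : ι → S → ℝ≥0) (C : Set S) :
    massOn (∑ i ∈ s, f i) C = ∑ i ∈ s, massOn (f i) C := map_sum (massLin C) f s

theorem massOn_smul (c : ℝ≥0) (μ : S → ℝ≥0) (C : Set S) : massOn (c • μ) C = c * massOn μ C :=
  (massLin C).map_smul c μ

open Classical in
theorem massOn_eq_sum (μ : S → ℝ≥0) (C : Set S) :
    massOn μ C = ∑ s, if s ∈ C then μ s else 0 := by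
  simp [massOn, Set.indicator_apply]

open Classical in
theorem massOn_dirac (s : S) (C : Set S) : massOn (dirac s) C = if s ∈ C then 1 else 0 := by
  rw [massOn_eq_sum, Finset.sum_eq_single s]
  · simp
  · intro t _ h; simp [dirac_apply, h]
  · simp

theorem continuous_massOn (C : Set S) : Continuous fun μ : S → ℝ≥0 => massOn μ C := by
  classical
  simp only [massOn_eq_sum]
  refine continuous_finsetSum _ fun s _ => ?_
  by_cases h : s ∈ C
  · simpa [h] using continuous_apply s
  · simpa [h] using continuous_const

theorem massOn_pos {μ : S → ℝ≥0} {C : Set S} {s : S} (hs : s ∈ C) (h : 0 < μ s) :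
    0 < massOn μ C := by
  classical
  rw [massOn_eq_sum]
  exact lt_of_lt_of_le (by simpa [hs] using h) (Finset.single_le_sum
    (f := fun s => if s ∈ C then μ s else 0) (fun _ _ => zero_le) (Finset.mem_univ s))

variable {M : MarkovAutomaton S Act} {α : M.ActChi} {x y z x' y' z' : S → ℝ≥0}

/-! ### Internal moves that do not change the class -/

/-- `ρ` is reached from `s` by internal transitions and is bisimilar to `s`. -/
def Move (M : MarkovAutomaton S Act) (s : S) (ρ : S → ℝ≥0) : Prop :=
  M.WeakFlow M.tauChi (dirac s) ρ ∧ M.FlowBisim ρ (dirac s)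

namespace Move

theorem refl (s : S) : M.Move s (dirac s) := ⟨WeakFlow.refl _, FlowBisim.refl _⟩

theorem bind {s : S} {ρ : S → ℝ≥0} {κ : S → S → ℝ≥0} (h : M.Move s ρ)
    (hκ : ∀ t, 0 < ρ t → M.Move t (κ t)) : M.Move s (∑ t, ρ t • κ t) := by
  refine ⟨h.1.tau_trans (WeakFlow.bind fun t ht => (hκ t ht).1), FlowBisim.trans ?_ h.2⟩
  conv => enter [3]; rw [← sum_smul_dirac ρ]
  refine FlowBisim.sum _ fun t _ => ?_
  rcases eq_or_ne (ρ t) 0 with h0 | h0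
  · simpa [h0] using FlowBisim.refl 0
  · exact (hκ t (pos_iff_ne_zero.mpr h0)).2.smul _

theorem size_eq {s : S} {ρ : S → ℝ≥0} (h : M.Move s ρ) : size ρ = 1 := by
  simpa using h.2.size_eq

theorem isCompact (M : MarkovAutomaton S Act) (s : S) : IsCompact {ρ | M.Move s ρ} := by
  refine (isCompact_size_le (X := S) 1).of_isClosed_subset ?_ fun ρ h => (Move.size_eq h).le
  exact ((WeakFlow.isClosed M M.tauChi).preimage (f := fun ρ => (dirac s, ρ)) (by fun_prop)).inter
    ((FlowBisim.isClosed M).preimage (f := fun ρ => (ρ, dirac s)) (by fun_prop))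

/-- A move whose outcome is a mixture is a mixture of moves, since bisimilarity is cancellative. -/
theorem of_mixture {s : S} {ι : Type*} [Fintype ι] {c : ι → ℝ≥0} {ν : ι → S → ℝ≥0}
    (h : M.Move s (∑ i, c i • ν i)) (hc : ∑ i, c i = 1)
    (hν : ∀ i, M.WeakFlow M.tauChi (dirac s) (ν i)) {i : ι} (hi : 0 < c i) : M.Move s (ν i) := by
  refine ⟨hν i, FlowBisim.of_smul hi.ne' (FlowBisim.of_sum (f := fun i => c i • dirac s)
    (g := fun i => c i • ν i) (fun i => (hν i).smul _) ?_ i)⟩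
  rw [← Finset.sum_smul, hc, one_smul]
  exact h.2

end Move

/-- Some move from `s` reaches `t` with positive probability. -/
def Leads (M : MarkovAutomaton S Act) (s t : S) : Prop := ∃ ρ, M.Move s ρ ∧ 0 < ρ t

theorem Leads.refl (s : S) : M.Leads s s := ⟨_, Move.refl s, by simp⟩

theorem Leads.trans {s t u : S} (h : M.Leads s t) (h' : M.Leads t u) : M.Leads s u := by
  obtain ⟨ρ, hρ, ht⟩ := h
  obtain ⟨κ, hκ, hu⟩ := h'
  refine ⟨_, hρ.bind (κ := fun v => if v = t then κ else dirac v) fun v _ => ?_, ?_⟩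
  · by_cases hv : v = t
    · subst hv; simpa using hκ
    · simpa [hv] using Move.refl v
  · rw [Finset.sum_apply]
    refine lt_of_lt_of_le ?_ (Finset.single_le_sum
      (f := fun v => (ρ v • (if v = t then κ else dirac v)) u) (fun _ _ => zero_le)
      (Finset.mem_univ t))
    simpa using ⟨ht, hu⟩

/-- If from every state of the closed set `Z` one can move into `B` with positive probability, then
one can move into `B` with certainty: a move that maximizes the mass on `B` could otherwise be
improved by moving on from the states outside `B`. -/
theorem exists_move_into {Z B : Set S} (hZ : ∀ s ∈ Z, ∀ t, M.Leads s t → t ∈ Z)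
    (hB : ∀ s ∈ Z, ∃ t ∈ B, M.Leads s t) {s : S} (hs : s ∈ Z) :
    ∃ ρ, M.Move s ρ ∧ ∀ t, 0 < ρ t → t ∈ B := by
  classical
  have hmax (s : S) : ∃ κ, M.Move s κ ∧ ∀ ρ, M.Move s ρ → massOn ρ B ≤ massOn κ B := by
    obtain ⟨κ, hκ, h⟩ := (Move.isCompact M s).exists_isMaxOn ⟨_, Move.refl s⟩
      (continuous_massOn B).continuousOn
    exact ⟨κ, hκ, fun ρ hρ => h hρ⟩
  choose κ hκ hopt using hmax
  refine ⟨κ s, hκ s, fun t ht => ?_⟩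
  by_contra htB
  have hbind := (hκ s).bind (κ := fun v => if v ∈ B then dirac v else κ v) fun v _ => by
    by_cases hv : v ∈ B
    · simpa [hv] using Move.refl v
    · simpa [hv] using hκ v
  have hle := hopt s _ hbind
  have hlt : massOn (κ s) B < massOn (∑ v, κ s v • if v ∈ B then dirac v else κ v) B := by
    conv_lhs => rw [← sum_smul_dirac (κ s)]
    rw [massOn_sum, massOn_sum]
    refine Finset.sum_lt_sum (fun v _ => ?_) ⟨t, Finset.mem_univ t, ?_⟩
    · rw [massOn_smul, massOn_smul, massOn_dirac]
      by_cases hv : v ∈ B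
      · simp [hv, massOn_dirac]
      · simp [hv]
    · rw [massOn_smul, massOn_smul, massOn_dirac, if_neg htB, if_neg htB, mul_zero]
      obtain ⟨u, hu, ρ, hρ, hρu⟩ := hB t (hZ s hs t ⟨_, hκ s, ht⟩)
      exact mul_pos ht ((massOn_pos hu hρu).trans_le (hopt t ρ hρ))
  exact absurd hle hlt.not_ge

/-- The bottom states of the preorder `Leads`. -/
def Bottom (M : MarkovAutomaton S Act) (t : S) : Prop := ∀ u, M.Leads t u → M.Leads u t

/-- A state that leads to as few states as possible is a bottom state. -/
theorem exists_bottom (s : S) : ∃ t, M.Leads s t ∧ M.Bottom t := by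
  classical
  obtain ⟨t, ht, hmin⟩ := (Finset.univ.filter fun t => M.Leads s t).exists_min_image
    (fun t => (Finset.univ.filter fun u => M.Leads t u).card) ⟨s, by simp [Leads.refl]⟩
  simp only [Finset.mem_filter, Finset.mem_univ, true_and] at ht hmin
  refine ⟨t, ht, fun u hu => ?_⟩
  have hsub : (Finset.univ.filter fun v => M.Leads u v) ⊆ Finset.univ.filter fun v => M.Leads t v :=
    fun v hv => by
      simp only [Finset.mem_filter, Finset.mem_univ, true_and] at hv ⊢
      exact hu.trans hv
  have := Finset.eq_of_subset_of_card_le hsub (hmin u (ht.trans hu))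
  have hmem : t ∈ Finset.univ.filter fun v => M.Leads u v := by
    rw [this]; simp [Leads.refl]
  simpa using hmem

/-- The moves of a bottom state stay in its class. -/
theorem Bottom.flowBisim {t u : S} (ht : M.Bottom t) (hu : M.Leads t u) :
    M.FlowBisim (dirac t) (dirac u) := by
  obtain ⟨ρ, hρ, hsupp⟩ := exists_move_into (Z := {v | M.Leads t v}) (B := {u})
    (fun v hv w hw => Leads.trans hv hw) (fun v hv => ⟨u, rfl, (ht v hv).trans hu⟩) (Leads.refl t)
  have hρu : ρ = ρ u • dirac u := by
    ext v
    by_cases hv : v = u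
    · subst hv; simp
    · have : ρ v = 0 := by
        by_contra h
        exact hv (hsupp v (pos_iff_ne_zero.mpr h))
      simp [this, dirac_apply, hv]
  have h1 := hρ.size_eq
  rw [hρu, size_smul, size_dirac, mul_one] at h1
  rw [h1, one_smul] at hρu
  exact hρu ▸ hρ.2.symm

theorem WeakFlow.combined {s : S} (h : M.WeakFlow α (dirac s) x) : Combined (M.WeakHat α) s x := by
  obtain ⟨ν, hν, rfl⟩ := h.lifted
  have : ∑ t, (dirac s : S → ℝ≥0) t • ν t = ν s := by simp [dirac_apply]
  rw [this]
  exact hν s (by simp)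

/-- Every state moves to bottom states, by a single tree. -/
theorem exists_weak_bottom (s : S) :
    ∃ ν, M.Weak s ν ∧ M.Move s ν ∧ ∀ t, 0 < ν t → M.Bottom t := by
  obtain ⟨ρ, hρ, hB⟩ := exists_move_into (M := M) (Z := Set.univ) (B := {t | M.Bottom t})
    (fun _ _ _ _ => trivial) (fun s _ => (exists_bottom s).imp fun t h => ⟨h.2, h.1⟩)
    (Set.mem_univ s)
  obtain ⟨n, c, ν, hc, hc1, hν, rfl⟩ := exists_parts_of_combined hρ.1.combined hρ.size_eq
  have hn : Nonempty (Fin n) := by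
    by_contra h
    rw [not_nonempty_iff] at h
    simp at hc1
  obtain ⟨i⟩ := hn
  refine ⟨ν i, M.weakHat_tau ▸ (hν i).1, hρ.of_mixture hc1 (fun i => (hν i).2) (hc i),
    fun t ht => hB t ?_⟩
  rw [Finset.sum_apply]
  exact (mul_pos (hc i) ht).trans_le (Finset.single_le_sum
    (f := fun i => (c i • ν i) t) (fun _ _ => zero_le) (Finset.mem_univ i))

/-- Every mass function evolves, without randomizing at the roots, into a bisimilar one supported in
bottom states. -/
theorem exists_lifted_bottom (x : S → ℝ≥0) :
    ∃ x', Lifted M.Weak x x' ∧ M.FlowBisim x x' ∧ ∀ t, 0 < x' t → M.Bottom t := by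
  choose ν hweak hmove hbot using exists_weak_bottom (M := M)
  refine ⟨_, ⟨ν, fun s _ => hweak s, rfl⟩, ?_, fun t ht => ?_⟩
  · conv => enter [2]; rw [← sum_smul_dirac x]
    exact FlowBisim.sum _ fun s _ => (hmove s).2.symm.smul _
  · rw [Finset.sum_apply] at ht
    obtain ⟨s, -, hs⟩ := Finset.exists_ne_zero_of_sum_ne_zero ht.ne'
    exact hbot s t (pos_iff_ne_zero.mpr (right_ne_zero_of_mul hs))

/-! ### Bisimilarity and the masses of classes -/

/-- The class of a state. -/
def stateClass (M : MarkovAutomaton S Act) (s : S) : Set S :=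
  {t | M.FlowBisim (dirac s) (dirac t)}

theorem massOn_sum_stateClass {f : S → S → ℝ≥0} {a : S → ℝ≥0} (hsize : ∀ s, size (f s) = a s)
    (hsupp : ∀ s t, 0 < f s t → M.FlowBisim (dirac s) (dirac t)) (r : S) :
    massOn (∑ s, f s) (M.stateClass r) = massOn a (M.stateClass r) := by
  classical
  rw [massOn_sum, massOn_eq_sum a]
  refine Finset.sum_congr rfl fun s _ => ?_
  rw [massOn_eq_sum]
  split_ifs with hs
  · rw [← hsize s]
    refine Finset.sum_congr rfl fun t _ => ?_
    rcases eq_or_ne (f s t) 0 with h0 | h0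
    · simp [h0]
    · exact if_pos (FlowBisim.trans hs (hsupp s t (pos_iff_ne_zero.mpr h0)))
  · refine Finset.sum_eq_zero fun t _ => ?_
    rcases eq_or_ne (f s t) 0 with h0 | h0
    · simp [h0]
    · exact if_neg fun ht =>
        hs (FlowBisim.trans ht (hsupp s t (pos_iff_ne_zero.mpr h0)).symm)

/-- What is bisimilar to a multiple of a bottom state lies in its class. -/
theorem Bottom.flowBisim_of_pos {s t : S} (hs : M.Bottom s) {c : ℝ≥0} (hc : c ≠ 0)
    (h : M.FlowBisim (c • dirac s) y) (ht : 0 < y t) : M.FlowBisim (dirac s) (dirac t) := by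
  obtain ⟨θ, hflow, hθ⟩ := h.symm.exists_pointwise
  have hbis : M.FlowBisim (∑ u, θ u) (c • dirac s) := by
    have := FlowBisim.sum Finset.univ fun u _ => hθ u
    rw [sum_smul_dirac] at this
    exact this.symm.trans h.symm
  have hmove : M.Move s (c⁻¹ • ∑ u, θ u) :=
    ⟨by simpa [smul_smul, hc] using hflow.smul c⁻¹, by simpa [smul_smul, hc] using hbis.smul c⁻¹⟩
  have hθt : M.FlowBisim (θ t) (size (θ t) • dirac s) := by
    conv => enter [2]; rw [← sum_smul_dirac (θ t)]
    rw [size, Finset.sum_smul]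
    refine FlowBisim.sum _ fun u _ => ?_
    rcases eq_or_ne (θ t u) 0 with h0 | h0
    · simpa [h0] using FlowBisim.refl 0
    · refine (hs.flowBisim ⟨_, hmove, ?_⟩).symm.smul _
      have : 0 < (∑ v, θ v) u := by
        rw [Finset.sum_apply]
        exact (pos_iff_ne_zero.mpr h0).trans_le (Finset.single_le_sum
          (f := fun v => θ v u) (fun _ _ => zero_le) (Finset.mem_univ t))
      exact mul_pos (inv_pos.mpr (pos_iff_ne_zero.mpr hc)) this
  have hsz : size (θ t) = y t := by simpa [size_smul] using (hθ t).size_eq.symm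
  rw [hsz] at hθt
  exact (FlowBisim.of_smul ht.ne' ((hθ t).trans hθt)).symm

/-- On mass functions supported in bottom states bisimilarity determines the masses of classes. -/
theorem massOn_eq_of_bottom (hx : ∀ t, 0 < x t → M.Bottom t) (hy : ∀ t, 0 < y t → M.Bottom t)
    (h : M.FlowBisim x y) (r : S) : massOn x (M.stateClass r) = massOn y (M.stateClass r) := by
  obtain ⟨ys, hflow, hs⟩ := h.exists_pointwise
  have hbis : M.FlowBisim (∑ s, ys s) y := by
    have := FlowBisim.sum Finset.univ fun s _ => hs s
    rw [sum_smul_dirac] at this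
    exact this.symm.trans h
  obtain ⟨ν, hν, heq⟩ := hflow.exists_pointwise
  have h1 : massOn (∑ s, ys s) (M.stateClass r) = massOn x (M.stateClass r) := by
    refine massOn_sum_stateClass (fun s => ?_) (fun s t ht => ?_) r
    · simpa [size_smul] using (hs s).size_eq.symm
    · rcases eq_or_ne (x s) 0 with h0 | h0
      · have := hs s
        rw [h0, zero_smul] at this
        rw [this.eq_zero] at ht
        exact absurd ht (lt_irrefl _)
      · exact (hx s (pos_iff_ne_zero.mpr h0)).flowBisim_of_pos h0 (hs s) ht
  have hpart (t : S) : M.FlowBisim (y t • ν t) (y t • dirac t) := by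
    refine FlowBisim.of_sum (f := fun t => y t • dirac t) (g := fun t => y t • ν t)
      (fun t => ?_) ?_ t
    · rcases eq_or_ne (y t) 0 with h0 | h0
      · simpa [h0] using WeakFlow.zero
      · exact (hν t (pos_iff_ne_zero.mpr h0)).smul _
    · rwa [← heq, sum_smul_dirac]
  have h2 : massOn (∑ s, ys s) (M.stateClass r) = massOn y (M.stateClass r) := by
    rw [heq]
    refine massOn_sum_stateClass (fun t => ?_) (fun t u hu => ?_) r
    · simpa [size_smul] using (hpart t).size_eq
    · have ht := left_ne_zero_of_mul hu.ne'
      exact (hy t (pos_iff_ne_zero.mpr ht)).flowBisim ⟨ν t,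
        ⟨hν t (pos_iff_ne_zero.mpr ht), (hpart t).of_smul ht⟩,
        pos_iff_ne_zero.mpr (right_ne_zero_of_mul hu.ne')⟩
  rw [← h1, h2]

/-- Mass functions that agree on classes are bisimilar: both are bisimilar to the mass function
that gathers each class in a representative. -/
theorem flowBisim_of_massOn_eq
    (h : ∀ r, massOn x (M.stateClass r) = massOn y (M.stateClass r)) : M.FlowBisim x y := by
  let st : Setoid S := ⟨fun s t => M.FlowBisim (dirac s) (dirac t),
    fun _ => FlowBisim.refl _, FlowBisim.symm, FlowBisim.trans⟩
  let rep : S → S := fun s => (Quotient.mk st s).out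
  have hrep (s : S) : M.FlowBisim (dirac s) (dirac (rep s)) :=
    (Quotient.exact (Quotient.out_eq (Quotient.mk st s))).symm
  have hgather (x : S → ℝ≥0) : M.FlowBisim x (push rep x) := by
    conv => enter [2]; rw [← sum_smul_dirac x]
    exact FlowBisim.sum _ fun s _ => (hrep s).smul _
  have hclass (s t : S) : rep s = rep t ↔ s ∈ M.stateClass (rep t) := by
    constructor
    · intro hst
      rw [← hst]
      exact (hrep s).symm
    · intro hs
      exact congrArg Quotient.out (Quotient.sound (s := st)
        (((hrep t).trans hs).symm : M.FlowBisim (dirac s) (dirac t)))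
  have heq : push rep x = push rep y := by
    classical
    ext t
    congr 1
    rw [push_eval, push_eval]
    by_cases ht : ∃ u, rep u = t
    · obtain ⟨u, rfl⟩ := ht
      simp only [hclass]
      rw [← massOn_eq_sum, ← massOn_eq_sum, h]
    · have (s : S) : rep s ≠ t := fun hs => ht ⟨s, hs⟩
      simp [this]
  exact (hgather x).trans (heq ▸ (hgather y).symm)

end MarkovAutomaton

namespace MarkovAutomaton

variable {S Act : Type*} [Fintype S] [DecidableEq S]

/-! ### From flows back to weak bisimulations -/

section

variable {M : MarkovAutomaton S Act} {α : M.ActChi} {x y z x' y' z' : S → ℝ≥0}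

/-- Since bisimilar mass functions have equal size, answers lose no mass, so that they are
flows. -/
theorem Answers.flowAnswers {R : (S → ℝ≥0) → (S → ℝ≥0) → Prop}
    (hR : ∀ x y, R x y → size x = size y) (h : R x y) (ha : M.Answers R x y) :
    M.FlowAnswers R x y := by
  intro s hs α
  obtain ⟨yg, yb, hy, hg, hb, hstep⟩ := ha s hs α
  have hsz : size y = size (yg + yb) := by
    rw [size_add, ← hR _ _ hg, ← hR _ _ hb, ← hR _ _ h, ← size_add, add_comm, removeState_add]
  refine ⟨yg, yb, lifted_weak_iff.mp ⟨hy, hsz⟩, hg, hb, fun ν hν => ?_⟩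
  obtain ⟨y', h1, h2⟩ := hstep ν hν
  refine ⟨y', WeakFlow.of_lifted h1 ?_, h2⟩
  rw [← hR _ _ hg, ← hR _ _ h2, size_smul, size_smul, hν.size_eq, size_dirac]

theorem FlowAnswers.answers {R : (S → ℝ≥0) → (S → ℝ≥0) → Prop} (ha : M.FlowAnswers R x y) :
    M.Answers R x y := by
  intro s hs α
  obtain ⟨yg, yb, hy, hg, hb, hstep⟩ := ha s hs α
  refine ⟨yg, yb, (lifted_weak_iff.mpr hy).1, hg, hb, fun ν hν => ?_⟩
  obtain ⟨y', h1, h2⟩ := hstep ν hν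
  exact ⟨y', h1.lifted, h2⟩

theorem bisim_iff : M.Bisim x y ↔ M.FlowBisim x y ∧ IsSubdist x ∧ IsSubdist y := by
  constructor
  · rintro ⟨R, hR, h⟩
    refine ⟨FlowBisim.of_relation (R := fun a b => R a b ∨ R b a) (fun a b => Or.symm) ?_ (.inl h),
      hR.subdist _ _ h⟩
    rintro a b (h | h)
    · exact ⟨hR.size_eq _ _ h, ((hR.left _ _ h).flowAnswers hR.size_eq h).mono fun _ _ => .inl⟩
    · exact ⟨(hR.size_eq _ _ h).symm, ((hR.right _ _ h).flowAnswers
        (fun a b hab => (hR.size_eq _ _ hab).symm) h).mono fun _ _ => .inr⟩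
  · rintro ⟨h, hx, hy⟩
    have hans : ∀ a b : S → ℝ≥0, M.FlowBisim a b ∧ IsSubdist a ∧ IsSubdist b →
        M.Answers (fun a b => M.FlowBisim a b ∧ IsSubdist a ∧ IsSubdist b) a b := by
      rintro a b ⟨h, ha, -⟩
      have hsub {v w : S → ℝ≥0} (hvw : M.FlowBisim v w) (hv : size v ≤ size a) :
          M.FlowBisim v w ∧ IsSubdist v ∧ IsSubdist w :=
        ⟨hvw, hv.trans ha, hvw.size_eq.symm.le.trans (hv.trans ha)⟩
      refine FlowAnswers.answers fun s hs α => ?_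
      obtain ⟨yg, yb, hy, hg, hb, hstep⟩ := h.answers s hs α
      refine ⟨yg, yb, hy, hsub hg ?_, hsub hb ?_, fun ν hν => ?_⟩
      · simpa [size_smul] using le_size a s
      · rw [← size_removeState_add a s]; exact le_self_add
      · obtain ⟨w, h1, h2⟩ := hstep ν hν
        exact ⟨w, h1, hsub h2 (by simpa [size_smul, hν.size_eq] using le_size a s)⟩
    refine ⟨_, ⟨fun _ _ h => h.2, fun _ _ h => h.1.size_eq, hans, fun a b h => ?_⟩, h, hx, hy⟩
    have := hans b a ⟨h.1.symm, h.2.2, h.2.1⟩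
    convert this using 3
    exact ⟨fun h => ⟨h.1.symm, h.2.2, h.2.1⟩, fun h => ⟨h.1.symm, h.2.2, h.2.1⟩⟩

theorem stateBisim_iff {s t : S} : M.StateBisim s t ↔ M.FlowBisim (dirac s) (dirac t) := by
  rw [StateBisim, bisim_iff]
  simp [IsSubdist]

theorem mem_bisimClasses {C : Set S} : C ∈ M.bisimClasses ↔ ∃ r, C = M.stateClass r := by
  simp only [bisimClasses, stateBisim_iff]
  rfl

theorem FlowBisim.exists_of_step {E F : S} (h : M.FlowBisim (dirac E) (dirac F))
    (hx : M.Step E α x) : ∃ y, Combined (M.WeakHat α) F y ∧ M.Bisim x y := by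
  obtain ⟨yg, yb, hy, -, hb, hstep⟩ := h.answers' E α
  have h0 := removeState_smul_dirac 1 E
  rw [one_smul] at h0
  rw [h0] at hb
  rw [hb.eq_zero, add_zero] at hy
  obtain ⟨y, h1, h2⟩ := hstep x hx
  rw [dirac_self, one_smul] at h2
  exact ⟨y, (hy.tau_trans h1).combined, bisim_iff.mpr ⟨h2, hx.size_eq.le,
    (h2.size_eq.symm.trans hx.size_eq).le⟩⟩

/-- A state answers by staying where it is and then using the given weak transition. -/
theorem flowAnswers_dirac {E F : S} {R : (S → ℝ≥0) → (S → ℝ≥0) → Prop}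
    (hR : R (dirac E) (dirac F))
    (h : ∀ (α : M.ActChi) (x : S → ℝ≥0), M.Step E α x →
      ∃ y, Combined (M.WeakHat α) F y ∧ M.Bisim x y) :
    M.FlowAnswers (fun a b => R a b ∨ M.FlowBisim a b) (dirac E) (dirac F) := by
  intro s hs α
  obtain rfl : s = E := by
    by_contra hne
    simp [dirac_apply, hne] at hs
  have h0 := removeState_smul_dirac 1 s
  rw [one_smul] at h0
  refine ⟨dirac F, 0, by simpa using WeakFlow.refl _, by simpa using .inl hR,
    by rw [h0]; exact .inr (.refl 0), fun ν hν => ?_⟩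
  obtain ⟨y, h1, h2⟩ := h α ν hν
  have h2 := (bisim_iff.mp h2).1
  exact ⟨y, .of_combined h1 (h2.size_eq ▸ hν.size_eq), by simpa using .inr h2⟩

theorem flowBisim_dirac {E F : S}
    (h : ∀ (α : M.ActChi) (x : S → ℝ≥0), M.Step E α x →
      ∃ y, Combined (M.WeakHat α) F y ∧ M.Bisim x y)
    (h' : ∀ (α : M.ActChi) (x : S → ℝ≥0), M.Step F α x →
      ∃ y, Combined (M.WeakHat α) E y ∧ M.Bisim x y) :
    M.FlowBisim (dirac E) (dirac F) := by
  refine FlowBisim.coinduct (R := fun a b => (a = dirac E ∧ b = dirac F) ∨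
    (a = dirac F ∧ b = dirac E)) ?_ ?_ (.inl ⟨rfl, rfl⟩)
  · rintro a b (⟨rfl, rfl⟩ | ⟨rfl, rfl⟩)
    exacts [.inr ⟨rfl, rfl⟩, .inl ⟨rfl, rfl⟩]
  · rintro a b (⟨rfl, rfl⟩ | ⟨rfl, rfl⟩)
    · exact ⟨by simp, flowAnswers_dirac (.inl ⟨rfl, rfl⟩) h⟩
    · exact ⟨by simp, flowAnswers_dirac (.inr ⟨rfl, rfl⟩) h'⟩

end

end MarkovAutomaton

theorem mainTheorem3 {S Act : Type*} [Fintype S] [DecidableEq S] [Finite Act]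
    (M : MarkovAutomaton S Act) :
    (∀ E F : S, M.StateBisim E F ↔
      (∀ (α : M.ActChi) (μ : S → ℝ≥0), M.Step E α μ →
        ∃ γ : S → ℝ≥0, Combined (M.WeakHat α) F γ ∧ M.Bisim μ γ) ∧
      (∀ (α : M.ActChi) (γ : S → ℝ≥0), M.Step F α γ →
        ∃ μ : S → ℝ≥0, Combined (M.WeakHat α) E μ ∧ M.Bisim γ μ)) ∧
    (∀ μ γ : S → ℝ≥0, IsDist μ → IsDist γ →
      (M.Bisim μ γ ↔
        ∃ μ' γ' : S → ℝ≥0, Lifted M.Weak μ μ' ∧ Lifted M.Weak γ γ' ∧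
          M.Bisim μ μ' ∧ M.Bisim γ γ' ∧
          ∀ C ∈ M.bisimClasses, massOn μ' C = massOn γ' C)) := by
  open MarkovAutomaton in
  refine ⟨fun E F => ?_, fun μ γ hμ hγ => ?_⟩
  · rw [stateBisim_iff]
    exact ⟨fun h => ⟨fun α _ hs => h.exists_of_step hs, fun α _ hs => h.symm.exists_of_step hs⟩,
      fun h => flowBisim_dirac h.1 h.2⟩
  · constructor
    · intro h
      obtain ⟨μ', hμμ', hbμ, hμbot⟩ := exists_lifted_bottom (M := M) μ
      obtain ⟨γ', hγγ', hbγ, hγbot⟩ := exists_lifted_bottom (M := M) γ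
      refine ⟨μ', γ', hμμ', hγγ', bisim_iff.mpr ⟨hbμ, hμ.le, hbμ.size_eq.symm.le.trans hμ.le⟩,
        bisim_iff.mpr ⟨hbγ, hγ.le, hbγ.size_eq.symm.le.trans hγ.le⟩, fun C hC => ?_⟩
      obtain ⟨r, rfl⟩ := mem_bisimClasses.mp hC
      exact massOn_eq_of_bottom hμbot hγbot
        ((hbμ.symm.trans (bisim_iff.mp h).1).trans hbγ) r
    · rintro ⟨μ', γ', -, -, hbμ, hbγ, hC⟩
      refine bisim_iff.mpr ⟨?_, hμ.le, hγ.le⟩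
      have := flowBisim_of_massOn_eq (M := M) fun r => hC _ (mem_bisimClasses.mpr ⟨r, rfl⟩)
      exact ((bisim_iff.mp hbμ).1.trans this).trans (bisim_iff.mp hbγ).1.symm
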